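/- Let $n\ge 1$ and let $P\subset\mathbb R^n$ be a regular $n$-dimensional convex polytope, that is, the convex hull of finitely many points, with nonempty interior, whose group of isometries acts transitively on its flags (maximal chains of nonempty faces). Let $v_1,\dots,v_V$ be the vertices of $P$. For $r\in(0,1)$ the Generalized Chaos Game on $P$ with ratio $r$ uses the maps $w_i(x)=(1-r)x+rv_i$, with regions $w_i(P)=(1-r)P+rv_i$. Call $r\in(0,1)$ an optimal ratio of $P$ if these regions touch without overlapping: for $i\ne j$ no point of $w_i(P)$ lies in the interior of $w_j(P)$, and every region $w_i(P)$ meets some other region $w_j(P)$, $j\neq i$. Then all edges of $P$ have the same length $\ell$; the maximum $\delta_\parallel$ of the distances $|v_i-v_j|$ between distinct vertices whose connecting vector $v_i-v_j$ is parallel to some edge of $P$ exists; and $P$ has exactly one optimal ratio, namely $$r_{\mathrm{opt}}=\frac{\delta_\parallel}{\delta_\parallel+\ell}.$$ In particular, write $\phi=\frac{1+\sqrt5}{2}$. The icosahedron with vertices $(0,\pm\phi,\pm1)$, $(\pm1,0,\pm\phi)$, $(\pm\phi,\pm1,0)$ has $\ell=2$ and $\delta_\parallel=2\phi$, and its unique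 optimal ratio is $r_{\mathrm{opt}}=1/\phi$. -/

import Mathlib

/-- An `n`-dimensional convex polytope in `ℝⁿ`: the convex hull of finitely many points,
with nonempty interior. -/
def IsConvexPolytope {n : ℕ} (P : Set (EuclideanSpace ℝ (Fin n))) : Prop :=
  (∃ S : Set (EuclideanSpace ℝ (Fin n)), S.Finite ∧ P = convexHull ℝ S) ∧ (interior P).Nonempty

/-- A nonempty face: a nonempty set of all maximisers on `P` of some linear functional
(`P` itself is a face, through the zero functional). -/
def IsFace {n : ℕ} (P F : Set (EuclideanSpace ℝ (Fin n))) : Prop :=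
  F.Nonempty ∧ IsExposed ℝ P F

/-- A flag: a maximal chain of nonempty faces, ordered by inclusion. -/
def IsFlag {n : ℕ} (P : Set (EuclideanSpace ℝ (Fin n)))
    (C : Set (Set (EuclideanSpace ℝ (Fin n)))) : Prop :=
  Maximal (fun D : Set (Set (EuclideanSpace ℝ (Fin n))) =>
    (∀ F ∈ D, IsFace P F) ∧ IsChain (· ⊆ ·) D) C

/-- A regular `n`-dimensional (convex) polytope: its isometry group is transitive on flags. -/
def IsRegularPolytope {n : ℕ} (P : Set (EuclideanSpace ℝ (Fin n))) : Prop :=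
  IsConvexPolytope P ∧
    ∀ C D : Set (Set (EuclideanSpace ℝ (Fin n))), IsFlag P C → IsFlag P D →
      ∃ g : EuclideanSpace ℝ (Fin n) ≃ᵃⁱ[ℝ] EuclideanSpace ℝ (Fin n),
        g '' P = P ∧ (fun F => g '' F) '' C = D

/-- The vertices of a polytope are its extreme points. -/
def polytopeVertices {n : ℕ} (P : Set (EuclideanSpace ℝ (Fin n))) :
    Set (EuclideanSpace ℝ (Fin n)) :=
  Set.extremePoints ℝ P

/-- `a` and `b` are the two ends of an edge (a one-dimensional face) of `P`. -/
def IsEdge {n : ℕ} (P : Set (EuclideanSpace ℝ (Fin n))) (a b : EuclideanSpace ℝ (Fin n)) : Prop :=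
  a ≠ b ∧ IsFace P (segment ℝ a b)

/-- `P` has edges, and all of them have length `ℓ`. -/
def HasEdgeLength {n : ℕ} (P : Set (EuclideanSpace ℝ (Fin n))) (ℓ : ℝ) : Prop :=
  (∃ a b, IsEdge P a b) ∧ ∀ a b, IsEdge P a b → dist a b = ℓ

/-- The distances between two distinct vertices whose connecting vector is parallel to
some edge; the number `δ∥` is the maximum of this set. -/
def edgeParallelDistances {n : ℕ} (P : Set (EuclideanSpace ℝ (Fin n))) : Set ℝ :=
  {d | ∃ a ∈ polytopeVertices P, ∃ b ∈ polytopeVertices P, a ≠ b ∧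
    (∃ c e, IsEdge P c e ∧ ∃ t : ℝ, b - a = t • (e - c)) ∧ d = dist a b}

/-- One step of the Generalized Chaos Game with ratio `r` towards the vertex `v`. -/
noncomputable def chaosMap {n : ℕ} (r : ℝ) (v x : EuclideanSpace ℝ (Fin n)) :
    EuclideanSpace ℝ (Fin n) :=
  (1 - r) • x + r • v

/-- The self-similar region `(1 - r) P + r v` belonging to the vertex `v`. -/
noncomputable def chaosRegion {n : ℕ} (P : Set (EuclideanSpace ℝ (Fin n))) (r : ℝ)
    (v : EuclideanSpace ℝ (Fin n)) : Set (EuclideanSpace ℝ (Fin n)) :=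
  chaosMap r v '' P

/-- `r ∈ (0, 1)` is an optimal ratio for `P`: the regions do not overlap (no point of one region
lies within the interior of another), and they touch (every region meets another one). -/
def IsOptimalRatio {n : ℕ} (P : Set (EuclideanSpace ℝ (Fin n))) (r : ℝ) : Prop :=
  r ∈ Set.Ioo (0 : ℝ) 1 ∧
  (∀ v ∈ polytopeVertices P, ∀ w ∈ polytopeVertices P, v ≠ w →
    Disjoint (chaosRegion P r v) (interior (chaosRegion P r w))) ∧
  (∀ v ∈ polytopeVertices P, ∃ w ∈ polytopeVertices P, w ≠ v ∧
    (chaosRegion P r v ∩ chaosRegion P r w).Nonempty)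

/-- The icosahedron with vertices `(0, ±φ, ±1)`, `(±1, 0, ±φ)`, `(±φ, ±1, 0)`. -/
noncomputable def icosahedron : Set (EuclideanSpace ℝ (Fin 3)) :=
  convexHull ℝ {x | ∃ s t : ℝ, (s = 1 ∨ s = -1) ∧ (t = 1 ∨ t = -1) ∧
    (x = !₂[0, s * Real.goldenRatio, t] ∨ x = !₂[s, 0, t * Real.goldenRatio] ∨
      x = !₂[s * Real.goldenRatio, t, 0])}

/-! ### Faces of a polytope and supporting hyperplanes. -/

section Faces

variable {n : ℕ} {P F G : Set (EuclideanSpace ℝ (Fin n))}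

/-! The regions of v and w share a point exactly when r(w - v) = (1 - r)(p - q) for some p, q in P,
so everything depends on comparing vertex differences with the difference body of P. Let δ be the
width of P in an edge direction. If a chord parallel to the edge attains this width, the regions at
the two ends of the edge touch at rℓ = (1 - r)δ and overlap for smaller r. If moreover any two
vertices v, w are at least ℓ apart when projected to some edge direction, no pair of regions can
meet beyond this threshold, nor overlap at it. These metric facts form `HasEdgeGeometry`, and
`HasEdgeGeometry.isOptimalRatio_iff` derives the ratio from them.

For a regular P, flag transitivity puts the vertices on a sphere about their mean c and makes all
edges congruent. The main step is `IsRegularPolytope.reflection_mem`: the symmetry that exchanges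
the vertex of a flag for the other end of its edge is the reflection in the bisector of that edge.
Reflecting an extreme vertex gives the chord of full width. A vertex off the mirror differs from its
image by at least ℓ, the least distance between vertices, hence lies at least ℓ/2 from the mirror.
For the separation, `IsConvexPolytope.inner_le_of_local_max` supplies an edge at v along which the
functional w - c increases; its far side of the mirror contains w, while v is ℓ/2 on the near side.

For the icosahedron the same metric facts are checked directly from the four possible inner products
of vertices, without proving regularity. -/

theorem IsConvexPolytope.isCompact (hP : IsConvexPolytope P) : IsCompact P := by
  obtain ⟨⟨S, hS, rfl⟩, -⟩ := hP
  exact hS.isCompact_convexHull ℝ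

theorem IsConvexPolytope.convex (hP : IsConvexPolytope P) : Convex ℝ P := by
  obtain ⟨⟨S, hS, rfl⟩, -⟩ := hP
  exact convex_convexHull ℝ S

theorem IsConvexPolytope.finite_vertices (hP : IsConvexPolytope P) :
    (polytopeVertices P).Finite := by
  obtain ⟨⟨S, hS, rfl⟩, -⟩ := hP
  exact hS.subset extremePoints_convexHull_subset

theorem IsConvexPolytope.convexHull_vertices (hP : IsConvexPolytope P) :
    convexHull ℝ (polytopeVertices P) = P := by
  have h : closure (convexHull ℝ (polytopeVertices P)) = P :=
    closure_convexHull_extremePoints hP.isCompact hP.convex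
  rwa [(hP.finite_vertices.isCompact_convexHull ℝ).isClosed.closure_eq] at h

theorem polytopeVertices_subset : polytopeVertices P ⊆ P := extremePoints_subset

/-- Upper bounds for a linear functional on the vertices extend to the polytope. -/
theorem IsConvexPolytope.inner_le (hP : IsConvexPolytope P) {l : EuclideanSpace ℝ (Fin n)} {h : ℝ}
    (hl : ∀ v ∈ polytopeVertices P, inner ℝ l v ≤ h) : ∀ x ∈ P, inner ℝ l x ≤ h := by
  have hc : Convex ℝ {x : EuclideanSpace ℝ (Fin n) | inner ℝ l x ≤ h} :=
    convex_halfSpace_le (innerSL ℝ l).isLinear h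
  intro x hx
  rw [← hP.convexHull_vertices] at hx
  exact convexHull_min hl hc hx

theorem IsFace.exists_support (hF : IsFace P F) :
    ∃ (l : EuclideanSpace ℝ (Fin n)) (h : ℝ), (∀ x ∈ P, inner ℝ l x ≤ h) ∧
      F = {x ∈ P | inner ℝ l x = h} := by
  obtain ⟨⟨x₀, hx₀⟩, hE⟩ := hF
  obtain ⟨l, rfl⟩ := hE ⟨x₀, hx₀⟩
  refine ⟨(InnerProductSpace.toDual ℝ _).symm l, l x₀, ?_, ?_⟩
  · intro x hx
    rw [InnerProductSpace.toDual_symm_apply]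
    exact hx₀.2 x hx
  · ext x
    simp only [InnerProductSpace.toDual_symm_apply, Set.mem_ofPred_eq]
    constructor
    · exact fun hx => ⟨hx.1, le_antisymm (hx₀.2 x hx.1) (hx.2 x₀ hx₀.1)⟩
    · exact fun hx => ⟨hx.1, fun y hy => hx.2 ▸ hx₀.2 y hy⟩

theorem isFace_of_support {l : EuclideanSpace ℝ (Fin n)} {h : ℝ}
    (hl : ∀ x ∈ P, inner ℝ l x ≤ h) (hne : {x ∈ P | inner ℝ l x = h}.Nonempty) :
    IsFace P {x ∈ P | inner ℝ l x = h} := by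
  refine ⟨hne, fun _ => ⟨innerSL ℝ l, ?_⟩⟩
  obtain ⟨x₀, hx₀, hx₀'⟩ := hne
  ext x
  simp only [Set.mem_ofPred_eq, innerSL_apply_apply]
  constructor
  · exact fun hx => ⟨hx.1, fun y hy => hx.2 ▸ hl y hy⟩
  · exact fun hx => ⟨hx.1, le_antisymm (hl x hx.1) (hx₀' ▸ hx.2 x₀ hx₀)⟩

theorem IsFace.subset (hF : IsFace P F) : F ⊆ P := hF.2.subset

theorem IsConvexPolytope.isFace_self (hP : IsConvexPolytope P) : IsFace P P :=
  ⟨hP.2.mono interior_subset, IsExposed.refl P⟩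

/-- A face is the convex hull of the vertices it contains. -/
theorem IsConvexPolytope.convexHull_face (hP : IsConvexPolytope P) (hF : IsFace P F) :
    convexHull ℝ (F ∩ polytopeVertices P) = F := by
  have hFc : IsCompact F := hP.isCompact.of_isClosed_subset
    (hF.2.isClosed hP.isCompact.isClosed) hF.subset
  have hFx : Convex ℝ F := hF.2.convex hP.convex
  have h1 : F.extremePoints ℝ = F ∩ polytopeVertices P := hF.2.isExtreme.extremePoints_eq
  have h2 := closure_convexHull_extremePoints hFc hFx
  rwa [h1, ((hP.finite_vertices.subset
    Set.inter_subset_right).isCompact_convexHull ℝ).isClosed.closure_eq] at h2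

/-- Faces are encoded by their vertex sets; this makes the face set finite and lets inclusions be
tested on vertices. -/
theorem IsConvexPolytope.face_subset_iff (hP : IsConvexPolytope P) (hF : IsFace P F)
    (hG : IsFace P G) : F ⊆ G ↔ F ∩ polytopeVertices P ⊆ G ∩ polytopeVertices P := by
  refine ⟨fun h => Set.inter_subset_inter_left _ h, fun h => ?_⟩
  rw [← hP.convexHull_face hF, ← hP.convexHull_face hG]
  exact convexHull_mono h

theorem IsConvexPolytope.face_ext (hP : IsConvexPolytope P) (hF : IsFace P F)
    (hG : IsFace P G) (h : F ∩ polytopeVertices P = G ∩ polytopeVertices P) : F = G := by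
  rw [← hP.convexHull_face hF, ← hP.convexHull_face hG, h]

theorem IsConvexPolytope.face_vertices_nonempty (hP : IsConvexPolytope P) (hF : IsFace P F) :
    (F ∩ polytopeVertices P).Nonempty := by
  have := hF.1
  rw [← hP.convexHull_face hF] at this
  exact convexHull_nonempty_iff.1 this

theorem IsConvexPolytope.finite_faces (hP : IsConvexPolytope P) : {F | IsFace P F}.Finite := by
  refine Set.Finite.of_finite_image (f := fun F => F ∩ polytopeVertices P)
    (hP.finite_vertices.finite_subsets.subset ?_) ?_
  · rintro _ ⟨F, -, rfl⟩
    exact Set.inter_subset_right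
  · intro F hF G hG h
    exact hP.face_ext hF hG h

/-- Every vertex of a polytope is a face. -/
theorem IsConvexPolytope.isFace_vertex (hP : IsConvexPolytope P) {v : EuclideanSpace ℝ (Fin n)}
    (hv : v ∈ polytopeVertices P) : IsFace P {v} := by
  have h1 : v ∉ convexHull ℝ (polytopeVertices P \ {v}) := by
    intro h
    have h2 := (hP.convex.mem_extremePoints_iff_mem_sdiff_convexHull_sdiff.1 hv).2
    exact h2 (convexHull_mono (Set.sdiff_subset_sdiff_left polytopeVertices_subset) h)
  have hcl : IsClosed (convexHull ℝ (polytopeVertices P \ {v})) :=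
    (hP.finite_vertices.subset Set.sdiff_subset).isCompact_convexHull ℝ |>.isClosed
  -- A functional strictly separating v from the hull of the other vertices has v as its only
  -- maximiser among the vertices.
  obtain ⟨f, u, hf, hu⟩ := geometric_hahn_banach_closed_point (convex_convexHull ℝ _) hcl h1
  set l := (InnerProductSpace.toDual ℝ _).symm f with hl
  have hlf : ∀ x, inner ℝ l x = f x := fun x => by
    rw [hl, InnerProductSpace.toDual_symm_apply]
  have hle : ∀ x ∈ P, inner ℝ l x ≤ f v := by
    refine hP.inner_le fun w hw => ?_
    rw [hlf]
    by_cases hwv : w = v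
    · rw [hwv]
    · exact ((hf w (subset_convexHull ℝ _ ⟨hw, hwv⟩)).trans hu).le
  have hface := isFace_of_support hle ⟨v, polytopeVertices_subset hv, hlf v⟩
  convert hface
  rw [← hP.convexHull_face hface, eq_comm]
  convert convexHull_singleton (𝕜 := ℝ) v
  ext w
  constructor
  · rintro ⟨⟨-, hw⟩, hwV⟩
    by_contra hwv
    have := (hf w (subset_convexHull ℝ _ ⟨hwV, hwv⟩)).trans hu
    rw [hlf] at hw
    exact this.ne hw
  · rintro rfl
    exact ⟨⟨polytopeVertices_subset hv, hlf w⟩, hv⟩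

/-- A supporting hyperplane of a face cuts out a face of the whole polytope. -/
theorem IsConvexPolytope.isFace_of_face (hP : IsConvexPolytope P) (hG : IsFace P G)
    {m : EuclideanSpace ℝ (Fin n)} {k : ℝ}
    (hm : ∀ v ∈ G ∩ polytopeVertices P, inner ℝ m v ≤ k)
    (hne : {x ∈ G | inner ℝ m x = k}.Nonempty) :
    IsFace P {x ∈ G | inner ℝ m x = k} := by
  obtain ⟨l, h, hl, hGe⟩ := hG.exists_support
  -- The functional l is constant on G and strictly smaller at the vertices outside G, so adding a
  -- large multiple K of it to m pushes those vertices below the level without changing the picture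
  -- on G. Any K above all the listed quotients works.
  obtain ⟨K, hK⟩ : ∃ K : ℝ, ∀ v ∈ polytopeVertices P \ G,
      (inner ℝ m v - k) / (h - inner ℝ l v) < K := by
    obtain ⟨K, hK⟩ := ((hP.finite_vertices.subset (Set.sdiff_subset (t := G))).image
      fun v => (inner ℝ m v - k) / (h - inner ℝ l v)).bddAbove
    exact ⟨K + 1, fun v hv => (hK ⟨v, hv, rfl⟩).trans_lt (lt_add_one K)⟩
  have hout : ∀ v ∈ polytopeVertices P \ G, inner ℝ (m + K • l) v < k + K * h := by
    intro v hv
    have hpos : 0 < h - inner ℝ l v := by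
      rcases (hl v (polytopeVertices_subset hv.1)).lt_or_eq with h1 | h1
      · linarith
      · exact absurd (by rw [hGe]; exact ⟨polytopeVertices_subset hv.1, h1⟩) hv.2
    have := (div_lt_iff₀ hpos).1 (hK v hv)
    rw [inner_add_left, real_inner_smul_left]
    linarith
  have hin : ∀ x ∈ G, inner ℝ (m + K • l) x = inner ℝ m x + K * h := by
    intro x hx
    rw [hGe] at hx
    rw [inner_add_left, real_inner_smul_left, hx.2]
  have hle : ∀ x ∈ P, inner ℝ (m + K • l) x ≤ k + K * h := by
    refine hP.inner_le fun v hv => ?_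
    by_cases hvG : v ∈ G
    · rw [hin v hvG]
      linarith [hm v ⟨hvG, hv⟩]
    · exact (hout v ⟨hv, hvG⟩).le
  have hface : IsFace P {x ∈ P | inner ℝ (m + K • l) x = k + K * h} := by
    refine isFace_of_support hle ?_
    obtain ⟨x, hx, hxk⟩ := hne
    exact ⟨x, hG.subset hx, by rw [hin x hx, hxk]⟩
  suffices heq : {x ∈ G | inner ℝ m x = k} = {x ∈ P | inner ℝ (m + K • l) x = k + K * h} from
    heq ▸ hface
  apply Set.Subset.antisymm
  · rintro x ⟨hx, hxk⟩
    exact ⟨hG.subset hx, by rw [hin x hx, hxk]⟩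
  · intro x hx
    have hxG : x ∈ G := by
      rw [← hP.convexHull_face hface] at hx
      refine convexHull_min ?_ (hG.2.convex hP.convex) hx
      rintro w ⟨⟨hwP, hw⟩, hwV⟩
      by_contra hwG
      exact (hout w ⟨hwV, hwG⟩).ne hw
    refine ⟨hxG, ?_⟩
    have := hx.2
    rw [hin x hxG] at this
    linarith

/-- Between two nested faces of codimension at least two there is a further face. -/
theorem IsConvexPolytope.exists_face_between (hP : IsConvexPolytope P) (hF : IsFace P F)
    (hG : IsFace P G) (hFG : F ⊆ G) {p q : EuclideanSpace ℝ (Fin n)} (hp : p ∈ G) (hpF : p ∉ F)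
    (hq : q ∈ G) (hqA : q ∉ affineSpan ℝ (insert p F)) :
    ∃ M, IsFace P M ∧ F ⊂ M ∧ M ⊂ G := by
  obtain ⟨l, h, hl, hFe⟩ := hF.exists_support
  obtain ⟨f₀, hf₀⟩ := hF.1
  have hf₀A : f₀ ∈ affineSpan ℝ (insert p F) := subset_affineSpan ℝ _ (Set.mem_insert_of_mem _ hf₀)
  -- The functional m is constant on F and p but not at q; it serves to rotate the hyperplane
  -- supporting F.
  obtain ⟨m, hm, hmq⟩ : ∃ m : EuclideanSpace ℝ (Fin n),
      (∀ x ∈ affineSpan ℝ (insert p F), inner ℝ m x = inner ℝ m f₀) ∧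
      inner ℝ m q ≠ inner ℝ m f₀ := by
    set W := (affineSpan ℝ (insert p F)).direction
    have hqW : q - f₀ ∉ W := fun hmem => hqA (by
      have := AffineSubspace.vadd_mem_of_mem_direction hmem hf₀A
      simpa using this)
    have hex : ∃ m ∈ Wᗮ, inner ℝ m (q - f₀) ≠ 0 := by
      by_contra! hcon
      apply hqW
      rw [← Submodule.orthogonal_orthogonal W, Submodule.mem_orthogonal]
      exact hcon
    obtain ⟨m, hmW, hmne⟩ := hex
    refine ⟨m, fun x hx => ?_, fun heq => hmne (by rw [inner_sub_right, heq, sub_self])⟩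
    have := (Submodule.mem_orthogonal' W m).1 hmW (x - f₀)
      (AffineSubspace.vsub_mem_direction hx hf₀A)
    rw [inner_sub_right] at this
    linarith
  have hlF : ∀ x ∈ G, x ∉ F → 0 < h - inner ℝ l x := by
    intro x hx hxF
    rcases (hl x (hG.subset hx)).lt_or_eq with h1 | h1
    · linarith
    · exact absurd (by rw [hFe]; exact ⟨hG.subset hx, h1⟩) hxF
  have hfin : ((G ∩ polytopeVertices P) \ F).Finite :=
    hP.finite_vertices.subset (Set.sdiff_subset.trans Set.inter_subset_right)
  have hnon : ((G ∩ polytopeVertices P) \ F).Nonempty := by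
    rw [Set.sdiff_nonempty]
    intro hsub
    apply hpF
    have := convexHull_min hsub (hF.2.convex hP.convex)
    rw [hP.convexHull_face hG] at this
    exact this hp
  -- The largest quotient β is the rotation at which the hyperplane m + βl still supports G along F
  -- and first hits a further vertex v₀.
  obtain ⟨v₀, ⟨⟨hv₀G, hv₀V⟩, hv₀F⟩, hmax⟩ := Set.exists_max_image _
    (fun v => (inner ℝ m v - inner ℝ m f₀) / (h - inner ℝ l v)) hfin hnon
  set β := (inner ℝ m v₀ - inner ℝ m f₀) / (h - inner ℝ l v₀) with hβ
  have hval : ∀ x, inner ℝ (m + β • l) x = inner ℝ m x + β * inner ℝ l x := fun x => by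
    rw [inner_add_left, real_inner_smul_left]
  have hF0 : ∀ x ∈ F, inner ℝ (m + β • l) x = inner ℝ m f₀ + β * h := by
    intro x hx
    rw [hval, hm x (subset_affineSpan ℝ _ (Set.mem_insert_of_mem _ hx))]
    rw [hFe] at hx
    rw [hx.2]
  have hface := hP.isFace_of_face hG (m := m + β • l) (k := inner ℝ m f₀ + β * h) (by
    intro v hv
    by_cases hvF : v ∈ F
    · exact (hF0 v hvF).le
    · have h1 := (div_le_iff₀ (hlF v hv.1 hvF)).1 (hmax v ⟨hv, hvF⟩)
      rw [hval]
      linarith) ⟨f₀, hFG hf₀, hF0 f₀ hf₀⟩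
  refine ⟨_, hface, ⟨fun x hx => ⟨hFG hx, hF0 x hx⟩, fun hsub => hv₀F (hsub ⟨hv₀G, ?_⟩)⟩,
    ⟨fun x hx => hx.1, fun hsub => ?_⟩⟩
  · have h1 := hlF v₀ hv₀G hv₀F
    have h2 : β * (h - inner ℝ l v₀) = inner ℝ m v₀ - inner ℝ m f₀ := by
      rw [hβ, div_mul_cancel₀ _ h1.ne']
    rw [hval]
    linarith
  -- If the new face were all of G, then p would force β = 0, and then q would contradict the choice
  -- of m.
  · have h1 := (hsub hp).2
    have h2 := (hsub hq).2
    rw [hval, hm p (subset_affineSpan ℝ _ (Set.mem_insert _ _))] at h1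
    have h3 := hlF p hp hpF
    have h4 : β * (h - inner ℝ l p) = 0 := by linarith
    have h5 : β = 0 := (mul_eq_zero.1 h4).resolve_right h3.ne'
    rw [hval, h5] at h2
    apply hmq
    linarith

theorem IsEdge.symm {a b : EuclideanSpace ℝ (Fin n)} (h : IsEdge P a b) : IsEdge P b a :=
  ⟨h.1.symm, segment_symm ℝ a b ▸ h.2⟩

theorem IsConvexPolytope.edge_vertices (hP : IsConvexPolytope P)
    {a b : EuclideanSpace ℝ (Fin n)} (h : IsEdge P a b) :
    segment ℝ a b ∩ polytopeVertices P = {a, b} := by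
  have h1 : (segment ℝ a b).extremePoints ℝ = segment ℝ a b ∩ polytopeVertices P :=
    h.2.2.isExtreme.extremePoints_eq
  have h2 : segment ℝ a b ∩ polytopeVertices P ⊆ {a, b} := by
    rw [← h1, ← convexHull_pair]
    exact extremePoints_convexHull_subset
  have h3 := hP.convexHull_face h.2
  have key : ∀ {a b : EuclideanSpace ℝ (Fin n)}, a ≠ b →
      segment ℝ a b ∩ polytopeVertices P ⊆ {a, b} →
      convexHull ℝ (segment ℝ a b ∩ polytopeVertices P) = segment ℝ a b →
      a ∈ segment ℝ a b ∩ polytopeVertices P := by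
    intro a b hab h2 h3
    by_contra ha
    have h4 : segment ℝ a b ∩ polytopeVertices P ⊆ {b} := fun x hx => by
      rcases h2 hx with rfl | rfl
      · exact absurd hx ha
      · rfl
    have h5 : a ∈ convexHull ℝ (segment ℝ a b ∩ polytopeVertices P) := by
      rw [h3]
      exact left_mem_segment ℝ a b
    have h6 := convexHull_mono (𝕜 := ℝ) h4 h5
    rw [convexHull_singleton] at h6
    exact hab h6
  refine Set.Subset.antisymm h2 ?_
  rintro x (rfl | rfl)
  · exact key h.1 h2 h3
  · have := key h.1.symm (by rwa [segment_symm, Set.pair_comm]) (by rwa [segment_symm])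
    rwa [segment_symm]

theorem IsConvexPolytope.edge_left (hP : IsConvexPolytope P)
    {a b : EuclideanSpace ℝ (Fin n)} (h : IsEdge P a b) : a ∈ polytopeVertices P := by
  have : a ∈ segment ℝ a b ∩ polytopeVertices P := by
    rw [hP.edge_vertices h]
    exact Set.mem_insert a {b}
  exact this.2

theorem IsConvexPolytope.edge_right (hP : IsConvexPolytope P)
    {a b : EuclideanSpace ℝ (Fin n)} (h : IsEdge P a b) : b ∈ polytopeVertices P :=
  hP.edge_left h.symm

end Faces

/-! ### Flags, symmetries and the mirrors of a regular polytope. -/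

section Symmetry

variable {n : ℕ} {P F : Set (EuclideanSpace ℝ (Fin n))}
  {C D : Set (Set (EuclideanSpace ℝ (Fin n)))}

theorem exists_isFlag_superset (hD : ∀ F ∈ D, IsFace P F) (hc : IsChain (· ⊆ ·) D) :
    ∃ C, D ⊆ C ∧ IsFlag P C := by
  refine zorn_subset_nonempty {D : Set (Set (EuclideanSpace ℝ (Fin n))) |
    (∀ F ∈ D, IsFace P F) ∧ IsChain (· ⊆ ·) D} ?_ D ⟨hD, hc⟩
  intro c hc hch _
  refine ⟨⋃₀ c, ⟨?_, ?_⟩, fun s hs => Set.subset_sUnion_of_mem hs⟩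
  · rintro F ⟨s, hs, hF⟩
    exact (hc hs).1 F hF
  · rintro F ⟨s, hs, hF⟩ G ⟨t, ht, hG⟩ hne
    rcases hch.total hs ht with h | h
    · exact (hc ht).2 (h hF) hG hne
    · exact (hc hs).2 hF (h hG) hne

theorem IsFlag.isFace (hC : IsFlag P C) (hF : F ∈ C) : IsFace P F := hC.1.1 F hF

theorem IsFlag.total (hC : IsFlag P C) {F G : Set (EuclideanSpace ℝ (Fin n))} (hF : F ∈ C)
    (hG : G ∈ C) : F ⊆ G ∨ G ⊆ F := hC.1.2.total hF hG

theorem IsFlag.mem_of_comparable (hC : IsFlag P C) (hF : IsFace P F)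
    (h : ∀ G ∈ C, F ⊆ G ∨ G ⊆ F) : F ∈ C := by
  have h1 : insert F C ⊆ C := hC.2 ⟨fun G hG => by
    rcases hG with rfl | hG
    · exact hF
    · exact hC.isFace hG, hC.1.2.insert fun G hG _ => h G hG⟩ (Set.subset_insert F C)
  exact h1 (Set.mem_insert F C)

theorem IsFlag.eq_of_singleton_mem (hC : IsFlag P C) {x y : EuclideanSpace ℝ (Fin n)}
    (hx : {x} ∈ C) (hy : {y} ∈ C) : x = y := by
  rcases hC.total hx hy with h | h
  · exact h rfl
  · exact (h rfl).symm

theorem AffineEquiv.image_extremePoints {E E' : Type*} [AddCommGroup E] [Module ℝ E]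
    [AddCommGroup E'] [Module ℝ E'] (g : E ≃ᵃ[ℝ] E') (s : Set E) :
    g '' s.extremePoints ℝ = (g '' s).extremePoints ℝ := by
  ext b
  obtain ⟨a, rfl⟩ := g.surjective b
  have : ∀ x y, g '' openSegment ℝ x y = openSegment ℝ (g x) (g y) := fun x y =>
    image_openSegment ℝ g.toAffineMap x y
  simp only [mem_extremePoints, g.surjective.forall, g.injective.mem_set_image,
    g.injective.eq_iff, ← this]

theorem AffineIsometryEquiv.image_polytopeVertices
    (g : EuclideanSpace ℝ (Fin n) ≃ᵃⁱ[ℝ] EuclideanSpace ℝ (Fin n)) (hg : g '' P = P) :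
    g '' polytopeVertices P = polytopeVertices P := by
  have h : g '' P.extremePoints ℝ = (g '' P).extremePoints ℝ :=
    g.toAffineEquiv.image_extremePoints P
  rwa [hg] at h

theorem AffineIsometryEquiv.image_segment
    (g : EuclideanSpace ℝ (Fin n) ≃ᵃⁱ[ℝ] EuclideanSpace ℝ (Fin n))
    (x y : EuclideanSpace ℝ (Fin n)) : g '' segment ℝ x y = segment ℝ (g x) (g y) :=
  _root_.image_segment ℝ g.toAffineEquiv.toAffineMap x y

theorem AffineIsometryEquiv.mem_polytopeVertices
    (g : EuclideanSpace ℝ (Fin n) ≃ᵃⁱ[ℝ] EuclideanSpace ℝ (Fin n)) (hg : g '' P = P)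
    {v : EuclideanSpace ℝ (Fin n)} (hv : v ∈ polytopeVertices P) : g v ∈ polytopeVertices P := by
  rw [← g.image_polytopeVertices hg]
  exact ⟨v, hv, rfl⟩

/-- The mean of a finite set: it is fixed by the symmetries of the set, and a linear functional
attains its maximum there only if it is constant on the set. -/
theorem Set.Finite.exists_mean {S : Set (EuclideanSpace ℝ (Fin n))} (hS : S.Finite)
    (hne : S.Nonempty) : ∃ c ∈ convexHull ℝ S,
      (∀ g : EuclideanSpace ℝ (Fin n) ≃ᵃⁱ[ℝ] EuclideanSpace ℝ (Fin n), g '' S = S → g c = c) ∧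
      ∀ (l : EuclideanSpace ℝ (Fin n)) (h : ℝ), (∀ v ∈ S, inner ℝ l v ≤ h) → inner ℝ l c = h →
        ∀ v ∈ S, inner ℝ l v = h := by
  lift S to Finset (EuclideanSpace ℝ (Fin n)) using hS
  have hk : (0 : ℝ) < S.card := by
    exact_mod_cast Finset.card_pos.2 (Finset.coe_nonempty.1 hne)
  refine ⟨(S.card : ℝ)⁻¹ • ∑ v ∈ S, v, ?_, ?_, ?_⟩
  · rw [Finset.smul_sum]
    refine (convex_convexHull ℝ _).sum_mem (fun _ _ => by positivity) ?_
      fun v hv => subset_convexHull ℝ _ hv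
    rw [Finset.sum_const, nsmul_eq_mul, mul_inv_cancel₀ hk.ne']
  · intro g hg
    have hgx : ∀ x, g x = g.linearIsometryEquiv x + g 0 := fun x => by
      simpa using g.map_vadd 0 x
    have himg : S.map ⟨g, g.injective⟩ = S := by
      ext x
      have := Set.ext_iff.1 hg x
      simpa using this
    have hsum : ∑ v ∈ S, g v = ∑ v ∈ S, v := by
      conv_rhs => rw [← himg]
      rw [Finset.sum_map]
      rfl
    have h2 : ∑ v ∈ S, g v = g.linearIsometryEquiv (∑ v ∈ S, v) + (S.card : ℝ) • g 0 := by
      rw [map_sum, Finset.sum_congr rfl fun v _ => hgx v, Finset.sum_add_distrib,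
        Finset.sum_const, Nat.cast_smul_eq_nsmul]
    rw [hgx, map_smul, ← hsum, h2, smul_add, smul_smul, inv_mul_cancel₀ hk.ne', one_smul, ← h2,
      hsum]
  · intro l h hl heq v hv
    rw [inner_smul_right, inner_sum, inv_mul_eq_iff_eq_mul₀ hk.ne'] at heq
    have h0 : ∑ v ∈ S, (h - inner ℝ l v) = 0 := by
      rw [Finset.sum_sub_distrib, heq, Finset.sum_const, nsmul_eq_mul, sub_self]
    have := (Finset.sum_eq_zero_iff_of_nonneg fun w hw => sub_nonneg.2 (hl w hw)).1 h0 v hv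
    linarith

theorem IsConvexPolytope.eq_of_face_subset_edge (hP : IsConvexPolytope P)
    {a b : EuclideanSpace ℝ (Fin n)} (h : IsEdge P a b) (hF : IsFace P F)
    (hFs : F ⊆ segment ℝ a b) : F = {a} ∨ F = {b} ∨ F = segment ℝ a b := by
  have h1 : F ∩ polytopeVertices P ⊆ {a, b} := by
    rw [← hP.edge_vertices h]
    exact Set.inter_subset_inter_left _ hFs
  have h2 := hP.convexHull_face hF
  have h3 := hP.face_vertices_nonempty hF
  rcases (Set.subset_pair_iff_eq.1 h1) with h4 | h4 | h4 | h4
  · exact absurd h4 h3.ne_empty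
  · rw [h4, convexHull_singleton] at h2
    exact Or.inl h2.symm
  · rw [h4, convexHull_singleton] at h2
    exact Or.inr (Or.inl h2.symm)
  · rw [h4, convexHull_pair] at h2
    exact Or.inr (Or.inr h2.symm)

theorem isChain_vertex_segment {a b : EuclideanSpace ℝ (Fin n)} :
    IsChain (· ⊆ ·) ({{a}, segment ℝ a b} : Set (Set (EuclideanSpace ℝ (Fin n)))) := by
  refine IsChain.pair ?_
  rintro _ rfl
  exact left_mem_segment ℝ _ b

/-- Every edge together with one of its ends belongs to a flag. -/
theorem IsConvexPolytope.exists_flag_edge (hP : IsConvexPolytope P)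
    {a b : EuclideanSpace ℝ (Fin n)} (h : IsEdge P a b) :
    ∃ C, IsFlag P C ∧ {a} ∈ C ∧ segment ℝ a b ∈ C := by
  obtain ⟨C, hDC, hC⟩ := exists_isFlag_superset (P := P) (D := {{a}, segment ℝ a b}) (by
    rintro F (rfl | rfl)
    · exact hP.isFace_vertex (hP.edge_left h)
    · exact h.2) isChain_vertex_segment
  exact ⟨C, hC, hDC (by simp), hDC (by simp)⟩

theorem IsRegularPolytope.exists_symm_vertex (hP : IsRegularPolytope P)
    {a b : EuclideanSpace ℝ (Fin n)} (ha : a ∈ polytopeVertices P)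
    (hb : b ∈ polytopeVertices P) :
    ∃ g : EuclideanSpace ℝ (Fin n) ≃ᵃⁱ[ℝ] EuclideanSpace ℝ (Fin n), g '' P = P ∧ g a = b := by
  have key : ∀ x ∈ polytopeVertices P, ∃ C, IsFlag P C ∧ {x} ∈ C := by
    intro x hx
    obtain ⟨C, hDC, hC⟩ := exists_isFlag_superset (P := P) (D := {{x}})
      (by rintro F rfl; exact hP.1.isFace_vertex hx) (Set.subsingleton_singleton.isChain)
    exact ⟨C, hC, hDC rfl⟩
  obtain ⟨C, hC, haC⟩ := key a ha
  obtain ⟨D, hD, hbD⟩ := key b hb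
  obtain ⟨g, hg, hgC⟩ := hP.2 C D hC hD
  refine ⟨g, hg, hD.eq_of_singleton_mem ?_ hbD⟩
  rw [← hgC]
  exact ⟨{a}, haC, Set.image_singleton⟩

/-- Carry a flag through the first vertex and edge to a flag through the second. The image of the
edge and the target edge lie in one chain, so one contains the other; as an edge has only two
vertices, the remaining ends agree. -/
theorem IsRegularPolytope.exists_symm_edge (hP : IsRegularPolytope P)
    {a b c d : EuclideanSpace ℝ (Fin n)} (h : IsEdge P a b) (h' : IsEdge P c d) :
    ∃ g : EuclideanSpace ℝ (Fin n) ≃ᵃⁱ[ℝ] EuclideanSpace ℝ (Fin n),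
      g '' P = P ∧ g a = c ∧ g b = d := by
  obtain ⟨C, hC, haC, habC⟩ := hP.1.exists_flag_edge h
  obtain ⟨D, hD, hcD, hcdD⟩ := hP.1.exists_flag_edge h'
  obtain ⟨g, hg, hgC⟩ := hP.2 C D hC hD
  have hga : g a = c := by
    refine hD.eq_of_singleton_mem ?_ hcD
    rw [← hgC]
    exact ⟨{a}, haC, Set.image_singleton⟩
  have hgab : segment ℝ c (g b) ∈ D := by
    rw [← hgC, ← hga, ← g.image_segment]
    exact ⟨_, habC, rfl⟩
  refine ⟨g, hg, hga, ?_⟩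
  have hedge : IsEdge P c (g b) := ⟨hga ▸ g.map_ne h.1, hD.isFace hgab⟩
  rcases hD.total hgab hcdD with hs | hs
  · have : g b ∈ segment ℝ c d ∩ polytopeVertices P :=
      ⟨hs (right_mem_segment ℝ _ _), hP.1.edge_right hedge⟩
    rw [hP.1.edge_vertices h'] at this
    exact this.resolve_left hedge.1.symm
  · have : d ∈ segment ℝ c (g b) ∩ polytopeVertices P :=
      ⟨hs (right_mem_segment ℝ _ _), hP.1.edge_right h'⟩
    rw [hP.1.edge_vertices hedge] at this
    exact (this.resolve_left h'.1.symm).symm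

/-- Every other member of a flag through a vertex and an edge contains the edge. -/
theorem IsFlag.segment_subset (hP : IsConvexPolytope P) {a b : EuclideanSpace ℝ (Fin n)}
    (h : IsEdge P a b) (hC : IsFlag P C) (haC : {a} ∈ C) (habC : segment ℝ a b ∈ C)
    (hF : F ∈ C) (hFa : F ≠ {a}) : segment ℝ a b ⊆ F := by
  rcases hC.total habC hF with h1 | h1
  · exact h1
  · rcases hP.eq_of_face_subset_edge h (hC.isFace hF) h1 with h2 | h2 | h2
    · exact absurd h2 hFa
    · subst h2
      exact absurd (hC.eq_of_singleton_mem haC hF) h.1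
    · exact h2.symm.subset

/-- Exchanging the vertex of a flag for the other end of its edge gives a flag. -/
theorem IsFlag.exchange_vertex (hP : IsConvexPolytope P) {a b : EuclideanSpace ℝ (Fin n)}
    (h : IsEdge P a b) (hC : IsFlag P C) (haC : {a} ∈ C) (habC : segment ℝ a b ∈ C) :
    IsFlag P (insert {b} (C \ {{a}})) := by
  have hseg : ∀ F ∈ C \ {{a}}, segment ℝ a b ⊆ F := fun F hF =>
    hC.segment_subset hP h haC habC hF.1 hF.2
  have hsa : segment ℝ a b ≠ {a} := fun heq => h.1 (by
    have := right_mem_segment ℝ a b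
    rw [heq] at this
    exact this.symm)
  refine ⟨⟨?_, ?_⟩, ?_⟩
  · rintro F (rfl | hF)
    · exact hP.isFace_vertex (hP.edge_right h)
    · exact hC.isFace hF.1
  · refine (hC.1.2.mono Set.sdiff_subset).insert fun F hF _ => Or.inl ?_
    rintro _ rfl
    exact hseg F hF (right_mem_segment ℝ _ _)
  · rintro D ⟨hDf, hDc⟩ hD F hF
    have hsD : segment ℝ a b ∈ D := hD (Or.inr ⟨habC, hsa⟩)
    have hbD : {b} ∈ D := hD (Or.inl rfl)
    have hbF : b ∈ F := by
      rcases hDc.total hbD hF with h1 | h1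
      · exact h1 rfl
      · obtain ⟨x, hx⟩ := (hDf F hF).1
        have : x = b := h1 hx
        exact this ▸ hx
    -- A face of D above the edge is comparable with {a} as well, hence with all of C, and
    -- maximality of C applies.
    have hfin : segment ℝ a b ⊆ F → F ∈ insert {b} (C \ {{a}}) := by
      intro hsF
      have hFa : F ≠ {a} := fun heq => h.1 (by rw [heq] at hbF; exact hbF.symm)
      refine Or.inr ⟨hC.mem_of_comparable (hDf F hF) fun G hG => ?_, hFa⟩
      by_cases hGa : G = {a}
      · right
        rw [hGa]
        rintro _ rfl
        exact hsF (left_mem_segment ℝ _ _)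
      · exact hDc.total hF (hD (Or.inr ⟨hG, hGa⟩))
    rcases hDc.total hsD hF with h1 | h1
    · exact hfin h1
    · rcases hP.eq_of_face_subset_edge h (hDf F hF) h1 with h2 | h2 | h2
      · rw [h2] at hbF
        exact absurd hbF.symm h.1
      · exact Or.inl h2
      · exact hfin h2.symm.subset

theorem inner_sub_eq_iff_dist_eq {a b p : EuclideanSpace ℝ (Fin n)} :
    dist p a = dist p b ↔ 2 * inner ℝ (b - a) p = inner ℝ b b - inner ℝ a a := by
  rw [dist_eq_norm, dist_eq_norm, ← sq_eq_sq₀ (norm_nonneg _) (norm_nonneg _),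
    ← real_inner_self_eq_norm_sq, ← real_inner_self_eq_norm_sq]
  simp only [inner_sub_left, inner_sub_right, real_inner_comm p]
  constructor <;> intro h <;> linarith

/-- The perpendicular bisector of an edge of a regular polytope is a mirror. -/
theorem IsRegularPolytope.reflection_mem (hP : IsRegularPolytope P)
    {a b c : EuclideanSpace ℝ (Fin n)} (h : IsEdge P a b) (hc : dist c a = dist c b) :
    ∃ g : EuclideanSpace ℝ (Fin n) ≃ᵃⁱ[ℝ] EuclideanSpace ℝ (Fin n), g '' P = P ∧
      ∀ x, g x = x - (2 * inner ℝ (b - a) (x - c) / inner ℝ (b - a) (b - a)) • (b - a) := by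
  obtain ⟨C, hC, haC, habC⟩ := hP.1.exists_flag_edge h
  have hD := hC.exchange_vertex hP.1 h haC habC
  have hseg : ∀ F ∈ C, F ≠ {a} → segment ℝ a b ⊆ F := fun F hF hFa =>
    hC.segment_subset hP.1 h haC habC hF hFa
  obtain ⟨g, hg, hgC⟩ := hP.2 _ _ hC hD
  refine ⟨g, hg, ?_⟩
  set u := b - a with hu
  have huu : inner ℝ u u ≠ 0 := fun h0 => h.1 (sub_eq_zero.1 (inner_self_eq_zero.1 h0)).symm
  have hga : g a = b := by
    refine hD.eq_of_singleton_mem ?_ (Set.mem_insert {b} _)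
    rw [← hgC]
    exact ⟨{a}, haC, Set.image_singleton⟩
  -- Both F and its image lie in the exchanged flag, so they are nested; having equally many
  -- vertices, they coincide.
  have hgF : ∀ F ∈ C, F ≠ {a} → g '' F = F := by
    intro F hF hFa
    have h1 : g '' F ∈ insert {b} (C \ {{a}}) := hgC ▸ ⟨F, hF, rfl⟩
    have h2 : F ∈ insert {b} (C \ {{a}}) := Or.inr ⟨hF, hFa⟩
    have hV : (g '' F) ∩ polytopeVertices P = g '' (F ∩ polytopeVertices P) := by
      rw [Set.image_inter g.injective, g.image_polytopeVertices hg]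
    have hfin : (F ∩ polytopeVertices P).Finite :=
      hP.1.finite_vertices.subset Set.inter_subset_right
    have hcard : (g '' F ∩ polytopeVertices P).ncard = (F ∩ polytopeVertices P).ncard := by
      rw [hV, Set.ncard_image_of_injective _ g.injective]
    refine hP.1.face_ext (hD.isFace h1) (hD.isFace h2) ?_
    rcases hD.total h1 h2 with h3 | h3
    · exact Set.eq_of_subset_of_ncard_le (Set.inter_subset_inter_left _ h3) hcard.ge hfin
    · exact (Set.eq_of_subset_of_ncard_le (Set.inter_subset_inter_left _ h3) hcard.le
        (hV ▸ hfin.image g)).symm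
  have hsa : segment ℝ a b ≠ {a} := fun heq => h.1 (by
    have := right_mem_segment ℝ a b
    rw [heq] at this
    exact this.symm)
  have hgb : g b = a := by
    have h1 := hgF _ habC hsa
    have h2 : g b ∈ segment ℝ a b ∩ polytopeVertices P :=
      ⟨h1 ▸ ⟨b, right_mem_segment ℝ _ _, rfl⟩,
        g.mem_polytopeVertices hg (hP.1.edge_right h)⟩
    rw [hP.1.edge_vertices h] at h2
    refine h2.resolve_right fun h3 => h.1 (g.injective ?_)
    rw [hga, h3]
  -- The affine map s is the expected reflection. The set M where g and s agree is closed under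
  -- affine span, and the aim is to grow it along the flag from the edge to P.
  let s : EuclideanSpace ℝ (Fin n) →ᵃ[ℝ] EuclideanSpace ℝ (Fin n) :=
    (LinearMap.id - (2 / inner ℝ u u) • ((innerₛₗ ℝ u).smulRight u)).toAffineMap +
      AffineMap.const ℝ _ ((2 / inner ℝ u u * inner ℝ u c) • u)
  have hs : ∀ x, s x = x - (2 * inner ℝ u (x - c) / inner ℝ u u) • u := by
    intro x
    have : s x = x - (2 / inner ℝ u u) • (inner ℝ u x • u) +
      (2 / inner ℝ u u * inner ℝ u c) • u := rfl
    rw [this, inner_sub_right u x c, smul_smul, sub_add, ← sub_smul]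
    congr 2
    ring
  let G : EuclideanSpace ℝ (Fin n) →ᵃ[ℝ] EuclideanSpace ℝ (Fin n) := g.toAffineEquiv
  have hG : ∀ x, G x = g x := fun x => rfl
  have hc' := inner_sub_eq_iff_dist_eq.1 hc
  have hcu : 2 * inner ℝ u (a - c) = - inner ℝ u u := by
    rw [← hu] at hc'
    rw [inner_sub_right, mul_sub, hc', hu]
    simp only [inner_sub_left, inner_sub_right, real_inner_comm a b]
    ring
  have hsa' : s a = b := by
    rw [hs, hcu, neg_div, div_self huu, hu]
    simp
  have hsb' : s b = a := by
    have h1 : 2 * inner ℝ u (b - c) = inner ℝ u u := by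
      have : b - c = u + (a - c) := by rw [hu]; abel
      rw [this, inner_add_right, mul_add, hcu]
      ring
    rw [hs, h1, div_self huu, hu]
    simp
  -- Since g sends a to b, a fixed point of g is equidistant from both, so it lies on the mirror of
  -- s.
  have hfix : ∀ p, g p = p → s p = p := by
    intro p hp
    have h1 : dist p a = dist p b := by
      have := g.dist_map p a
      rw [hp, hga] at this
      exact this.symm
    have h2 := inner_sub_eq_iff_dist_eq.1 h1
    have h3 : inner ℝ u (p - c) = 0 := by
      rw [inner_sub_right]
      linarith
    rw [hs, h3]
    simp
  set M := {x | g x = s x} with hM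
  have hspan : ∀ X : Set (EuclideanSpace ℝ (Fin n)), X ⊆ M → (affineSpan ℝ X : Set _) ⊆ M :=
    fun X hX => AffineMap.eqOn_affineSpan (f := G) (g := s) hX
  have hPC : P ∈ C := hC.mem_of_comparable hP.1.isFace_self fun F hF =>
    Or.inr (hC.isFace hF).subset
  have hCfin : C.Finite := hP.1.finite_faces.subset fun F hF => hC.isFace hF
  have habM : segment ℝ a b ⊆ M := by
    rw [← convexHull_pair]
    refine (convexHull_subset_affineSpan _).trans (hspan _ ?_)
    rintro x (rfl | rfl)
    · change g _ = s _
      rw [hga, hsa']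
    · change g _ = s _
      rw [hgb, hsb']
  obtain ⟨F, hFmax⟩ := (hCfin.subset (Set.sep_subset C fun F => segment ℝ a b ⊆ F ∧ F ⊆ M)
    ).exists_maximal ⟨_, habC, subset_rfl, habM⟩
  obtain ⟨⟨hFC, habF, hFM⟩, hFmax⟩ := hFmax
  -- Otherwise let H be the next face of the flag. The mean p of its vertices is fixed by g and lies
  -- outside F. If p and F span H, then g and s agree on H, against the maximality of F; if not, a
  -- face strictly between F and H would belong to the flag, against the minimality of H.
  have hFP : F = P := by
    by_contra hne
    obtain ⟨H, ⟨⟨hHC, hFH⟩, hHmin⟩⟩ := (hCfin.subset (Set.sep_subset C fun H => F ⊂ H)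
      ).exists_minimal ⟨P, hPC, (hC.isFace hFC).subset.ssubset_of_ne hne⟩
    have habH := habF.trans hFH.subset
    have hHa : H ≠ {a} := fun heq => h.1 (by
      have := habH (right_mem_segment ℝ a b)
      rw [heq] at this
      exact this.symm)
    have hHV : g '' (H ∩ polytopeVertices P) = H ∩ polytopeVertices P := by
      rw [Set.image_inter g.injective, g.image_polytopeVertices hg, hgF H hHC hHa]
    obtain ⟨p, hpH, hgp, hpl⟩ := (hP.1.finite_vertices.subset
      (Set.inter_subset_right (s := H))).exists_mean (hP.1.face_vertices_nonempty (hC.isFace hHC))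
    rw [hP.1.convexHull_face (hC.isFace hHC)] at hpH
    have hpM : p ∈ M := by
      change g p = s p
      rw [hgp g hHV, hfix p (hgp g hHV)]
    -- If p were in F, the functional supporting F would be constant on the vertices of H, so H
    -- would lie in F.
    have hpF : p ∉ F := by
      intro hpF
      obtain ⟨l, k, hl, hFe⟩ := (hC.isFace hFC).exists_support
      have hpk : inner ℝ l p = k := by
        rw [hFe] at hpF
        exact hpF.2
      have h1 := hpl l k (fun v hv => hl v (polytopeVertices_subset hv.2)) hpk
      refine hFH.2 ((hP.1.face_subset_iff (hC.isFace hHC) (hC.isFace hFC)).2 fun v hv => ⟨?_, hv.2⟩)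
      rw [hFe]
      exact ⟨polytopeVertices_subset hv.2, h1 v hv⟩
    by_cases hHsub : H ⊆ affineSpan ℝ (insert p F)
    · have hHM : H ⊆ M := hHsub.trans (hspan _ (Set.insert_subset hpM hFM))
      exact hFH.2 (hFmax ⟨hHC, habH, hHM⟩ hFH.subset)
    · obtain ⟨q, hq, hqA⟩ := Set.not_subset.1 hHsub
      obtain ⟨N, hN, hFN, hNH⟩ := hP.1.exists_face_between (hC.isFace hFC) (hC.isFace hHC)
        hFH.subset hpH hpF hq hqA
      have hNC : N ∈ C := by
        refine hC.mem_of_comparable hN fun K hK => ?_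
        by_cases hFK : F ⊂ K
        · rcases hC.total hHC hK with h1 | h1
          · exact Or.inl (hNH.subset.trans h1)
          · exact Or.inl (hNH.subset.trans (hHmin ⟨hK, hFK⟩ h1))
        · right
          rcases hC.total hFC hK with h1 | h1
          · exact (of_not_not fun h2 => hFK ⟨h1, h2⟩ : K ⊆ F).trans hFN.subset
          · exact h1.trans hFN.subset
      exact hNH.2 (hHmin ⟨hNC, hFN⟩ hNH.subset)
  have hPspan : affineSpan ℝ P = ⊤ := by
    have := hP.1.2
    rw [← (hP.1.convex).convexHull_eq] at this
    exact interior_convexHull_nonempty_iff_affineSpan_eq_top.1 this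
  intro x
  have hx : x ∈ (affineSpan ℝ P : Set (EuclideanSpace ℝ (Fin n))) := by
    rw [hPspan]
    trivial
  rw [← hs]
  exact hspan P (hFP ▸ hFM) hx

end Symmetry

/-! ### From edge geometry to the optimal ratio. -/

section EdgeGeometry

variable {n : ℕ} {P F : Set (EuclideanSpace ℝ (Fin n))}

/-- The metric data of a polytope that determine its optimal ratio: all edges have length `ℓ`,
in every edge direction the polytope has width `δ`, attained by a chord between vertices, and any
two vertices are separated by at least `ℓ` in some edge direction. -/
structure HasEdgeGeometry (P : Set (EuclideanSpace ℝ (Fin n))) (ℓ δ : ℝ) : Prop where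
  polytope : IsConvexPolytope P
  length_pos : 0 < ℓ
  width_pos : 0 < δ
  dist_eq : ∀ a b, IsEdge P a b → dist a b = ℓ
  exists_edge : ∀ v ∈ polytopeVertices P, ∃ x, IsEdge P v x
  width_le : ∀ a b, IsEdge P a b → ∀ p ∈ polytopeVertices P, ∀ q ∈ polytopeVertices P,
    inner ℝ (b - a) (p - q) ≤ δ * ℓ
  exists_chord : ∀ a b, IsEdge P a b → ∃ p ∈ polytopeVertices P, ∃ q ∈ polytopeVertices P,
    p - q = (δ / ℓ) • (b - a)
  separated : ∀ v ∈ polytopeVertices P, ∀ w ∈ polytopeVertices P, v ≠ w →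
    ∃ a b, IsEdge P a b ∧ ℓ ^ 2 ≤ inner ℝ (b - a) (w - v)

namespace HasEdgeGeometry

variable {ℓ δ : ℝ}

theorem hasEdgeLength (h : HasEdgeGeometry P ℓ δ) : HasEdgeLength P ℓ := by
  obtain ⟨v, -, hv⟩ := h.polytope.face_vertices_nonempty h.polytope.isFace_self
  obtain ⟨x, hx⟩ := h.exists_edge v hv
  exact ⟨⟨v, x, hx⟩, h.dist_eq⟩

theorem inner_self_edge (h : HasEdgeGeometry P ℓ δ) {a b : EuclideanSpace ℝ (Fin n)}
    (hab : IsEdge P a b) : inner ℝ (b - a) (b - a) = ℓ ^ 2 := by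
  rw [real_inner_self_eq_norm_sq, ← dist_eq_norm, dist_comm, h.dist_eq a b hab]

/-- The chord attains δ. Conversely, t(e - c) projects to its own length |t|ℓ in the direction of
the edge, so that length is at most the width. -/
theorem isGreatest (h : HasEdgeGeometry P ℓ δ) : IsGreatest (edgeParallelDistances P) δ := by
  have hℓ := h.length_pos
  have hδ := h.width_pos
  constructor
  · obtain ⟨⟨a, b, hab⟩, -⟩ := h.hasEdgeLength
    obtain ⟨p, hp, q, hq, hpq⟩ := h.exists_chord a b hab
    have hd : dist q p = δ := by
      rw [dist_comm, dist_eq_norm, hpq, norm_smul, ← dist_eq_norm, dist_comm, h.dist_eq a b hab,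
        Real.norm_of_nonneg (by positivity), div_mul_cancel₀ _ hℓ.ne']
    refine ⟨q, hq, p, hp, fun heq => ?_, ⟨a, b, hab, _, hpq⟩, hd.symm⟩
    rw [heq, dist_self] at hd
    exact hδ.ne hd
  · rintro d ⟨a, ha, b, hb, -, ⟨c, e, hce, t, ht⟩, rfl⟩
    have h1 := h.width_le c e hce b hb a ha
    have h2 := h.width_le c e hce a ha b hb
    rw [← neg_sub b a, inner_neg_right] at h2
    rw [ht, real_inner_smul_right, h.inner_self_edge hce] at h1 h2
    have h3 : |t| * ℓ ^ 2 ≤ δ * ℓ := by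
      rcases abs_cases t with ⟨h4, -⟩ | ⟨h4, -⟩ <;> rw [h4] <;> linarith
    rw [dist_comm, dist_eq_norm, ht, norm_smul, ← dist_eq_norm, dist_comm, h.dist_eq c e hce,
      Real.norm_eq_abs]
    nlinarith

theorem width_le_of_mem (h : HasEdgeGeometry P ℓ δ) {a b p q : EuclideanSpace ℝ (Fin n)}
    (hab : IsEdge P a b) (hp : p ∈ P) (hq : q ∈ P) : inner ℝ (b - a) (p - q) ≤ δ * ℓ := by
  have h1 : ∀ w ∈ polytopeVertices P, inner ℝ (b - a) p - inner ℝ (b - a) w ≤ δ * ℓ := by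
    intro w hw
    have := h.polytope.inner_le (l := b - a) (h := δ * ℓ + inner ℝ (b - a) w) (fun v hv => by
      have := h.width_le a b hab v hv w hw
      rw [inner_sub_right] at this
      linarith) p hp
    linarith
  have h2 := h.polytope.inner_le (l := -(b - a)) (h := δ * ℓ - inner ℝ (b - a) p) (fun w hw => by
    have := h1 w hw
    rw [inner_neg_left]
    linarith) q hq
  rw [inner_neg_left] at h2
  rw [inner_sub_right]
  linarith

/-- Regions that meet force the ratio to be small enough. -/
theorem ratio_mul_le (h : HasEdgeGeometry P ℓ δ) {r : ℝ} (hr : r ∈ Set.Ioo (0 : ℝ) 1)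
    {v w : EuclideanSpace ℝ (Fin n)} (hv : v ∈ polytopeVertices P) (hw : w ∈ polytopeVertices P)
    (hvw : v ≠ w) (hne : (chaosRegion P r v ∩ chaosRegion P r w).Nonempty) :
    r * ℓ ≤ (1 - r) * δ := by
  obtain ⟨_, ⟨p, hp, rfl⟩, ⟨q, hq, hpq⟩⟩ := hne
  obtain ⟨a, b, hab, hsep⟩ := h.separated v hv w hw hvw
  have h1 := h.width_le_of_mem hab hp hq
  have h2 : r • (w - v) = (1 - r) • (p - q) := by
    unfold chaosMap at hpq
    rw [smul_sub, smul_sub, sub_eq_sub_iff_add_eq_add]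
    rw [add_comm, hpq, add_comm]
  have h3 : r * inner ℝ (b - a) (w - v) = (1 - r) * inner ℝ (b - a) (p - q) := by
    rw [← real_inner_smul_right, ← real_inner_smul_right, h2]
  have h4 : r * ℓ ^ 2 ≤ (1 - r) * (δ * ℓ) := by
    calc r * ℓ ^ 2 ≤ r * inner ℝ (b - a) (w - v) := mul_le_mul_of_nonneg_left hsep hr.1.le
      _ = _ := h3
      _ ≤ _ := mul_le_mul_of_nonneg_left h1 (by linarith [hr.2])
  have := h.length_pos
  nlinarith

/-- If a region meets the interior of another one, the ratio is strictly smaller than the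
touching ratio. -/
theorem ratio_mul_lt (h : HasEdgeGeometry P ℓ δ) {r : ℝ} (hr : r ∈ Set.Ioo (0 : ℝ) 1)
    {v w : EuclideanSpace ℝ (Fin n)} (hv : v ∈ polytopeVertices P) (hw : w ∈ polytopeVertices P)
    (hvw : v ≠ w) (hne : (chaosRegion P r v ∩ interior (chaosRegion P r w)).Nonempty) :
    r * ℓ < (1 - r) * δ := by
  obtain ⟨y, hyv, hyw⟩ := hne
  obtain ⟨a, b, hab, hsep⟩ := h.separated v hv w hw hvw
  have hℓ := h.length_pos
  -- The common point is moved slightly against the edge direction without leaving the region of w;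
  -- this adds εℓ² to the projected separation and makes the inequality strict.
  obtain ⟨ε, hε, hball⟩ : ∃ ε : ℝ, 0 < ε ∧ y - ε • (b - a) ∈ chaosRegion P r w := by
    have hcont : ContinuousAt (fun ε : ℝ => y - ε • (b - a)) 0 := by fun_prop
    have hev : ∀ᶠ ε in nhds (0 : ℝ), y - ε • (b - a) ∈ interior (chaosRegion P r w) := by
      refine hcont.eventually_mem ?_
      rw [zero_smul, sub_zero]
      exact isOpen_interior.mem_nhds hyw
    obtain ⟨ε, h1, h2⟩ := ((hev.filter_mono nhdsWithin_le_nhds).and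
      (self_mem_nhdsWithin (s := Set.Ioi (0 : ℝ)))).exists
    exact ⟨ε, h2, interior_subset h1⟩
  obtain ⟨p, hp, rfl⟩ := hyv
  obtain ⟨q, hq, hpq⟩ := hball
  have h1 := h.width_le_of_mem hab hp hq
  have h2 : r • (w - v) + ε • (b - a) = (1 - r) • (p - q) := by
    unfold chaosMap at hpq
    linear_combination (norm := module) hpq
  have h3 : r * inner ℝ (b - a) (w - v) + ε * ℓ ^ 2 = (1 - r) * inner ℝ (b - a) (p - q) := by
    rw [← h.inner_self_edge hab, ← real_inner_smul_right, ← real_inner_smul_right,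
      ← real_inner_smul_right, ← inner_add_right, h2]
  have h4 : r * ℓ ^ 2 < (1 - r) * (δ * ℓ) := by
    calc r * ℓ ^ 2 ≤ r * inner ℝ (b - a) (w - v) := mul_le_mul_of_nonneg_left hsep hr.1.le
      _ < r * inner ℝ (b - a) (w - v) + ε * ℓ ^ 2 := by
        have : 0 < ε * ℓ ^ 2 := by positivity
        linarith
      _ = _ := h3
      _ ≤ _ := mul_le_mul_of_nonneg_left h1 (by linarith [hr.2])
  nlinarith

/-- Touching forces rℓ ≤ (1 - r)δ, and strict inequality would make the regions at the ends of an
edge overlap. At equality the width bound excludes overlap, and the parallel chord provides the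
contact. -/
theorem isOptimalRatio_iff (h : HasEdgeGeometry P ℓ δ) (r : ℝ) :
    IsOptimalRatio P r ↔ r = δ / (δ + ℓ) := by
  have hℓ := h.length_pos
  have hδ := h.width_pos
  have hiff : r = δ / (δ + ℓ) ↔ r * ℓ = (1 - r) * δ := by
    rw [eq_div_iff (by positivity)]
    constructor <;> intro h <;> linarith
  rw [hiff]
  constructor
  · rintro ⟨hr, hdis, htouch⟩
    obtain ⟨⟨a, b, hab⟩, -⟩ := h.hasEdgeLength
    have ha := h.polytope.edge_left hab
    have hb := h.polytope.edge_right hab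
    obtain ⟨w, hw, hwa, hne⟩ := htouch a ha
    refine (h.ratio_mul_le hr ha hw hwa.symm hne).antisymm ?_
    by_contra! hlt
    obtain ⟨p, hp, q, hq, hpq⟩ := h.exists_chord a b hab
    obtain ⟨z, hz⟩ := h.polytope.2
    have h1r : 0 < 1 - r := by linarith [hr.2]
    -- The factor θ shortens the chord so that (1 - r)θ(p - q) = r(b - a). Strict inequality means θ
    -- < 1, so contracting towards the interior point z carries q into the interior of P, while both
    -- contracted ends give the same point of the two regions.
    set θ := r * ℓ / ((1 - r) * δ) with hθ
    have hθ0 : 0 < θ := div_pos (mul_pos hr.1 hℓ) (by positivity)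
    have hθ1 : θ < 1 := (div_lt_one (by positivity)).2 hlt
    have hθr : (1 - r) * (θ * (δ / ℓ)) = r := by
      rw [hθ]
      field_simp
    have hq' : θ • q + (1 - θ) • z ∈ interior P :=
      h.polytope.convex.combo_self_interior_mem_interior (polytopeVertices_subset hq) hz
        hθ0.le (by linarith) (by ring)
    have hp' : θ • p + (1 - θ) • z ∈ P :=
      h.polytope.convex (polytopeVertices_subset hp) (interior_subset hz)
        hθ0.le (by linarith) (by ring)
    have hint : chaosMap r b '' interior P ⊆ interior (chaosRegion P r b) := by
      refine interior_maximal (Set.image_mono interior_subset) ?_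
      have : chaosMap r b = (Homeomorph.smulOfNeZero (1 - r) h1r.ne').trans
          (Homeomorph.addRight (r • b)) := rfl
      rw [this]
      exact (Homeomorph.isOpenMap _) _ isOpen_interior
    refine Set.disjoint_left.1 (hdis a ha b hb hab.1) ⟨_, hp', rfl⟩ (hint ⟨_, hq', ?_⟩)
    unfold chaosMap
    have h2 : p = q + (δ / ℓ) • (b - a) := by
      rw [← hpq]
      abel
    rw [h2]
    have h3 : (1 - r) • (θ • (q + (δ / ℓ) • (b - a)) + (1 - θ) • z) + r • a =
        (1 - r) • (θ • q + (1 - θ) • z) + (((1 - r) * (θ * (δ / ℓ))) • (b - a) + r • a) := by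
      module
    rw [h3, hθr]
    module
  · intro heq
    have hr : r ∈ Set.Ioo (0 : ℝ) 1 := by
      have := hiff.2 heq
      rw [this]
      exact ⟨by positivity, (div_lt_one (by positivity)).2 (by linarith)⟩
    refine ⟨hr, fun v hv w hw hvw => ?_, fun v hv => ?_⟩
    · rw [Set.disjoint_iff_inter_eq_empty]
      by_contra hne
      exact (h.ratio_mul_lt hr hv hw hvw (Set.nonempty_iff_ne_empty.2 hne)).ne heq
    · obtain ⟨x, hx⟩ := h.exists_edge v hv
      obtain ⟨p, hp, q, hq, hpq⟩ := h.exists_chord v x hx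
      refine ⟨x, h.polytope.edge_right hx, hx.1.symm, chaosMap r v p,
        ⟨p, polytopeVertices_subset hp, rfl⟩, ⟨q, polytopeVertices_subset hq, ?_⟩⟩
      have h2 : p = q + (δ / ℓ) • (x - v) := by
        rw [← hpq]
        abel
      have h3 : (1 - r) * (δ / ℓ) = r := by
        rw [← mul_div_assoc, ← heq, mul_div_cancel_right₀ _ hℓ.ne']
      unfold chaosMap
      rw [h2, smul_add, smul_smul, h3]
      module

end HasEdgeGeometry

/-! ### Edges and local maxima of inscribed polytopes. -/

theorem inner_sub_sub_of_dist_eq {c x y : EuclideanSpace ℝ (Fin n)} {R : ℝ}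
    (hx : dist x c = R) (hy : dist y c = R) :
    inner ℝ (x - c) (y - c) = R ^ 2 - dist x y ^ 2 / 2 := by
  have h1 := norm_sub_sq_real (x - c) (y - c)
  rw [sub_sub_sub_cancel_right, ← dist_eq_norm, ← dist_eq_norm, ← dist_eq_norm, hx, hy] at h1
  linarith

/-- In a polytope inscribed in a sphere, a vertex of a face is joined by an edge to every nearest
other vertex of that face. -/
theorem IsConvexPolytope.isEdge_of_forall_dist_le (hP : IsConvexPolytope P)
    {c : EuclideanSpace ℝ (Fin n)} {R : ℝ} (hR : ∀ v ∈ polytopeVertices P, dist v c = R)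
    (hF : IsFace P F) {v w : EuclideanSpace ℝ (Fin n)} (hv : v ∈ polytopeVertices P)
    (hvF : v ∈ F) (hw : w ∈ polytopeVertices P) (hwF : w ∈ F) (hvw : v ≠ w)
    (hmin : ∀ x ∈ F ∩ polytopeVertices P, x ≠ v → dist v w ≤ dist v x) : IsEdge P v w := by
  refine ⟨hvw, ?_⟩
  -- On the sphere, m evaluated at x is a constant minus half of |v - x|² + |w - x|². At v and w
  -- this sum equals |v - w|², and at every other vertex of F it is larger because w is nearest to
  -- v.
  set m := (v - c) + (w - c) with hm
  set k := 2 * R ^ 2 - dist v w ^ 2 / 2 + inner ℝ m c with hk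
  have hval : ∀ x ∈ polytopeVertices P,
      inner ℝ m x = 2 * R ^ 2 - (dist v x ^ 2 + dist w x ^ 2) / 2 + inner ℝ m c := by
    intro x hx
    have h1 : inner ℝ m x = inner ℝ m (x - c) + inner ℝ m c := by
      rw [← inner_add_right, sub_add_cancel]
    rw [h1, hm, inner_add_left _ _ (x - c), inner_sub_sub_of_dist_eq (hR v hv) (hR x hx),
      inner_sub_sub_of_dist_eq (hR w hw) (hR x hx)]
    ring
  have hlt : ∀ x ∈ F ∩ polytopeVertices P, x ≠ v → x ≠ w → inner ℝ m x < k := by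
    intro x hx hxv hxw
    rw [hval x hx.2, hk]
    have h1 : dist v w ^ 2 ≤ dist v x ^ 2 :=
      pow_le_pow_left₀ dist_nonneg (hmin x hx hxv) 2
    have h2 : 0 < dist w x ^ 2 := pow_pos (dist_pos.2 hxw.symm) 2
    linarith
  have hvk : inner ℝ m v = k := by
    rw [hval v hv, hk, dist_self, dist_comm w v]
    ring
  have hwk : inner ℝ m w = k := by
    rw [hval w hw, hk, dist_self]
    ring
  have hface := hP.isFace_of_face hF (m := m) (k := k) (by
    intro x hx
    by_cases hxv : x = v
    · rw [hxv, hvk]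
    by_cases hxw : x = w
    · rw [hxw, hwk]
    exact (hlt x hx hxv hxw).le) ⟨v, hvF, hvk⟩
  have heq : {x ∈ F | inner ℝ m x = k} ∩ polytopeVertices P = {v, w} := by
    ext x
    constructor
    · rintro ⟨⟨hxF, hxk⟩, hxV⟩
      by_contra hx
      rw [Set.mem_insert_iff, Set.mem_singleton_iff, not_or] at hx
      exact (hlt x ⟨hxF, hxV⟩ hx.1 hx.2).ne hxk
    · rintro (rfl | rfl)
      · exact ⟨⟨hvF, hvk⟩, hv⟩
      · exact ⟨⟨hwF, hwk⟩, hw⟩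
  have h1 := hP.convexHull_face hface
  rw [heq, convexHull_pair] at h1
  rw [h1]
  exact hface

theorem IsConvexPolytope.exists_nearest_edge (hP : IsConvexPolytope P)
    {c : EuclideanSpace ℝ (Fin n)} {R : ℝ} (hR : ∀ v ∈ polytopeVertices P, dist v c = R)
    (hF : IsFace P F) {v : EuclideanSpace ℝ (Fin n)} (hv : v ∈ polytopeVertices P) (hvF : v ∈ F)
    (hne : ∃ x ∈ F ∩ polytopeVertices P, x ≠ v) :
    ∃ w ∈ F, IsEdge P v w ∧ ∀ x ∈ F ∩ polytopeVertices P, x ≠ v → dist v w ≤ dist v x := by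
  obtain ⟨w, ⟨⟨hwF, hwV⟩, hwv⟩, hmin⟩ := Set.exists_min_image ((F ∩ polytopeVertices P) \ {v})
    (fun x => dist v x)
    (hP.finite_vertices.subset (Set.sdiff_subset.trans Set.inter_subset_right))
    (by obtain ⟨x, hx, hxv⟩ := hne; exact ⟨x, hx, hxv⟩)
  have hmin' : ∀ x ∈ F ∩ polytopeVertices P, x ≠ v → dist v w ≤ dist v x :=
    fun x hx hxv => hmin x ⟨hx, hxv⟩
  exact ⟨w, hwF, hP.isEdge_of_forall_dist_le hR hF hv hvF hwV hwF (Ne.symm hwv) hmin', hmin'⟩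

/-- A vertex of an inscribed polytope at which a linear functional is maximal among the ends of
its edges is a maximum on all vertices. -/
theorem IsConvexPolytope.inner_le_of_local_max (hP : IsConvexPolytope P)
    {c : EuclideanSpace ℝ (Fin n)} {R : ℝ} (hR : ∀ v ∈ polytopeVertices P, dist v c = R)
    {v f : EuclideanSpace ℝ (Fin n)} (hv : v ∈ polytopeVertices P)
    (hf : ∀ x, IsEdge P v x → inner ℝ f x ≤ inner ℝ f v) :
    ∀ y ∈ polytopeVertices P, inner ℝ f y ≤ inner ℝ f v := by
  by_contra! hcon
  obtain ⟨y₀, hy₀, hy₀f⟩ := hcon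
  have hl : ∀ y ∈ polytopeVertices P, y ≠ v → 0 < inner ℝ (v - c) v - inner ℝ (v - c) y := by
    intro y hy hyv
    have h1 := inner_sub_sub_of_dist_eq (hR v hv) (hR y hy)
    have h2 := inner_sub_sub_of_dist_eq (hR v hv) (hR v hv)
    rw [dist_self] at h2
    have h3 : 0 < dist v y ^ 2 := pow_pos (dist_pos.2 hyv.symm) 2
    rw [inner_sub_right] at h1 h2
    linarith
  have hy₀v : y₀ ≠ v := by
    rintro rfl
    exact hy₀f.false
  obtain ⟨y₁, ⟨hy₁, hy₁v⟩, hmax⟩ := Set.exists_max_image (polytopeVertices P \ {v})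
    (fun y => (inner ℝ f y - inner ℝ f v) / (inner ℝ (v - c) v - inner ℝ (v - c) y))
    (hP.finite_vertices.subset Set.sdiff_subset) ⟨y₀, hy₀, hy₀v⟩
  -- On the sphere v - c peaks only at v. With β the least multiple of it that makes v a maximum,
  -- the maximal face of f + β(v - c) contains a second vertex, hence an edge from v; along that
  -- edge f increases, since β > 0.
  set β := (inner ℝ f y₁ - inner ℝ f v) / (inner ℝ (v - c) v - inner ℝ (v - c) y₁) with hβ
  have hβ0 : 0 < β := (div_pos (by linarith) (hl y₀ hy₀ hy₀v)).trans_le (hmax y₀ ⟨hy₀, hy₀v⟩)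
  have hval : ∀ x, inner ℝ (f + β • (v - c)) x = inner ℝ f x + β * inner ℝ (v - c) x :=
    fun x => by rw [inner_add_left, real_inner_smul_left]
  have hface := isFace_of_support (P := P) (l := f + β • (v - c))
    (h := inner ℝ (f + β • (v - c)) v) (hP.inner_le fun y hy => by
      by_cases hyv : y = v
      · rw [hyv]
      · have := (div_le_iff₀ (hl y hy hyv)).1 (hmax y ⟨hy, hyv⟩)
        rw [hval, hval]
        linarith) ⟨v, polytopeVertices_subset hv, rfl⟩
  obtain ⟨x, ⟨-, hxF⟩, hx, -⟩ := hP.exists_nearest_edge hR hface hv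
    ⟨polytopeVertices_subset hv, rfl⟩ ⟨y₁, ⟨⟨polytopeVertices_subset hy₁, by
      have := div_mul_cancel₀ (inner ℝ f y₁ - inner ℝ f v) (hl y₁ hy₁ hy₁v).ne'
      rw [← hβ] at this
      rw [hval, hval]
      linarith⟩, hy₁⟩, hy₁v⟩
  have h1 := hf x hx
  have h2 := mul_pos hβ0 (hl x (hP.edge_right hx) hx.1.symm)
  rw [hval, hval] at hxF
  linarith

/-! ### Edge geometry of regular polytopes. -/

theorem IsConvexPolytope.nontrivial_vertices (hP : IsConvexPolytope P) (hn : 1 ≤ n) :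
    (polytopeVertices P).Nontrivial := by
  rw [← Set.not_subsingleton_iff]
  intro hs
  have : Nonempty (Fin n) := ⟨⟨0, hn⟩⟩
  obtain ⟨v, -, hv⟩ := hP.face_vertices_nonempty hP.isFace_self
  have h1 : polytopeVertices P = {v} := hs.eq_singleton_of_mem hv
  have h2 := hP.convexHull_vertices
  rw [h1, convexHull_singleton] at h2
  have h3 := hP.2
  rw [← h2, interior_singleton] at h3
  exact Set.not_nonempty_empty h3

/-- Here ℓ is the least distance between vertices, and δ = 2H/ℓ, where H is the maximum of the
functional b - a on the vertices, measured from the centre c; by symmetry H is the same for every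
edge. -/
theorem IsRegularPolytope.hasEdgeGeometry (hP : IsRegularPolytope P) (hn : 1 ≤ n) :
    ∃ ℓ δ, HasEdgeGeometry P ℓ δ := by
  obtain ⟨v₀, -, hv₀⟩ := hP.1.face_vertices_nonempty hP.1.isFace_self
  obtain ⟨c, -, hgc, -⟩ := hP.1.finite_vertices.exists_mean ⟨v₀, hv₀⟩
  have hR : ∀ v ∈ polytopeVertices P, dist v c = dist v₀ c := by
    intro v hv
    obtain ⟨g, hg, hgv⟩ := hP.exists_symm_vertex hv₀ hv
    rw [← g.dist_map v₀ c, hgv, hgc g (g.image_polytopeVertices hg)]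
  have hother : ∀ v ∈ polytopeVertices P, ∃ x ∈ P ∩ polytopeVertices P, x ≠ v := by
    intro v _
    obtain ⟨x, hx, hxv⟩ := (hP.1.nontrivial_vertices hn).exists_ne v
    exact ⟨x, ⟨polytopeVertices_subset hx, hx⟩, hxv⟩
  have hnear := fun v hv => hP.1.exists_nearest_edge hR hP.1.isFace_self hv
    (polytopeVertices_subset hv) (hother v hv)
  obtain ⟨w₀, -, hE₀, -⟩ := hnear v₀ hv₀
  set ℓ := dist v₀ w₀ with hℓ
  have hℓ0 : 0 < ℓ := dist_pos.2 hE₀.1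
  have hlen : ∀ a b, IsEdge P a b → dist a b = ℓ := by
    intro a b hab
    obtain ⟨g, -, hga, hgb⟩ := hP.exists_symm_edge hE₀ hab
    rw [hℓ, ← g.dist_map v₀ w₀, hga, hgb]
  have hmin : ∀ v ∈ polytopeVertices P, ∀ w ∈ polytopeVertices P, v ≠ w → ℓ ≤ dist v w := by
    intro v hv w hw hvw
    obtain ⟨x, -, hx, hxmin⟩ := hnear v hv
    rw [← hlen v x hx]
    exact hxmin w ⟨polytopeVertices_subset hw, hw⟩ hvw.symm
  have hsq : ∀ a b, IsEdge P a b → inner ℝ (b - a) (b - a) = ℓ ^ 2 := by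
    intro a b hab
    rw [real_inner_self_eq_norm_sq, ← dist_eq_norm, dist_comm, hlen a b hab]
  have hrefl : ∀ a b, IsEdge P a b → ∀ x ∈ polytopeVertices P,
      x - (2 * inner ℝ (b - a) (x - c) / ℓ ^ 2) • (b - a) ∈ polytopeVertices P := by
    intro a b hab x hx
    obtain ⟨g, hg, hgx⟩ := hP.reflection_mem (c := c) hab (by
      rw [dist_comm c a, dist_comm c b, hR a (hP.1.edge_left hab), hR b (hP.1.edge_right hab)])
    rw [← hsq a b hab, ← hgx]
    exact g.mem_polytopeVertices hg hx
  -- The vertex x and its mirror image are distinct vertices at distance tℓ, so t ≥ 1.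
  have hgap : ∀ a b, IsEdge P a b → ∀ x ∈ polytopeVertices P, 0 < inner ℝ (b - a) (x - c) →
      ℓ ^ 2 / 2 ≤ inner ℝ (b - a) (x - c) := by
    intro a b hab x hx hpos
    set t := 2 * inner ℝ (b - a) (x - c) / ℓ ^ 2 with ht
    have ht0 : 0 < t := by positivity
    have hd : dist x (x - t • (b - a)) = t * ℓ := by
      rw [dist_eq_norm, sub_sub_cancel, norm_smul, ← dist_eq_norm, dist_comm, hlen a b hab,
        Real.norm_of_nonneg ht0.le]
    have h1 := hmin x hx _ (hrefl a b hab x hx) (by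
      rw [← dist_pos, hd]
      positivity)
    rw [hd] at h1
    have h2 : 1 ≤ t := by
      by_contra! h3
      nlinarith
    rw [ht, le_div_iff₀ (by positivity)] at h2
    linarith
  obtain ⟨p₀, hp₀, hp₀max⟩ := Set.exists_max_image (polytopeVertices P)
    (fun x => inner ℝ (w₀ - v₀) (x - c)) hP.1.finite_vertices ⟨v₀, hv₀⟩
  set H := inner ℝ (w₀ - v₀) (p₀ - c) with hH
  -- The ends of an edge are symmetric about the mirror through c, so a lies ℓ/2 behind it.
  have hhalf : ∀ a b, IsEdge P a b → inner ℝ (b - a) (a - c) = -(ℓ ^ 2 / 2) := by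
    intro a b hab
    have h1 := inner_sub_sub_of_dist_eq (hR a (hP.1.edge_left hab)) (hR b (hP.1.edge_right hab))
    have h2 := inner_sub_sub_of_dist_eq (hR a (hP.1.edge_left hab)) (hR a (hP.1.edge_left hab))
    rw [hlen a b hab] at h1
    rw [dist_self] at h2
    have h3 : b - a = (b - c) - (a - c) := by abel
    rw [h3, inner_sub_left, real_inner_comm, h1, h2]
    ring
  have hHpos : 0 < H := by
    refine lt_of_lt_of_le ?_ (hp₀max w₀ (hP.1.edge_right hE₀))
    have h1 := hhalf v₀ w₀ hE₀
    have h2 := hsq v₀ w₀ hE₀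
    have h3 : w₀ - c = (w₀ - v₀) + (v₀ - c) := by abel
    change 0 < inner ℝ (w₀ - v₀) (w₀ - c)
    rw [h3, inner_add_right, h1, h2]
    have : 0 < ℓ ^ 2 := by positivity
    linarith
  -- A symmetry carrying one edge to the other fixes c, so it preserves the measured functional.
  have htop : ∀ a b, IsEdge P a b → (∀ x ∈ polytopeVertices P, inner ℝ (b - a) (x - c) ≤ H) ∧
      ∃ p ∈ polytopeVertices P, inner ℝ (b - a) (p - c) = H := by
    intro a b hab
    obtain ⟨g, hg, hga, hgb⟩ := hP.exists_symm_edge hE₀ hab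
    have hval : ∀ x, inner ℝ (b - a) (g x - c) = inner ℝ (w₀ - v₀) (x - c) := by
      intro x
      have h1 := g.map_vsub w₀ v₀
      have h2 := g.map_vsub x c
      rw [vsub_eq_sub, vsub_eq_sub, hga, hgb] at h1
      rw [vsub_eq_sub, vsub_eq_sub, hgc g (g.image_polytopeVertices hg)] at h2
      rw [← h1, ← h2, LinearIsometryEquiv.inner_map_map]
    refine ⟨fun x hx => ?_, g p₀, g.mem_polytopeVertices hg hp₀, hval p₀⟩
    rw [← g.image_polytopeVertices hg] at hx
    obtain ⟨y, hy, rfl⟩ := hx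
    rw [hval]
    exact hp₀max y hy
  refine ⟨ℓ, 2 * H / ℓ, hP.1, hℓ0, by positivity, hlen, fun v hv => ?_, fun a b hab p hp q hq => ?_,
    fun a b hab => ?_, fun v hv w hw hvw => ?_⟩
  · obtain ⟨x, -, hx, -⟩ := hnear v hv
    exact ⟨x, hx⟩
  · rw [div_mul_cancel₀ _ hℓ0.ne']
    have h1 := (htop a b hab).1 p hp
    have h2 := (htop b a hab.symm).1 q hq
    rw [← neg_sub b a, inner_neg_left] at h2
    have h3 : p - q = (p - c) - (q - c) := by abel
    rw [h3, inner_sub_right]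
    linarith
  -- The chord joins an extreme vertex to its mirror image.
  · obtain ⟨p, hp, hpH⟩ := (htop a b hab).2
    refine ⟨p, hp, _, hrefl a b hab p hp, ?_⟩
    rw [sub_sub_cancel, hpH]
    congr 1
    field_simp
  -- If w - c increased along an edge from v to x, `hgap` and `hhalf` would add up to the excluded
  -- bound ℓ². So v is a local, hence global, maximum of w - c, although on the sphere this
  -- functional is strictly larger at w.
  · by_contra! hcon
    have h1 := hP.1.inner_le_of_local_max hR (f := w - c) hv (fun x hx => by
      by_contra! hlt
      have h2 : inner ℝ (x - v) (w - c) = inner ℝ (w - c) x - inner ℝ (w - c) v := by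
        rw [real_inner_comm, inner_sub_right]
      have h3 := hgap v x hx w hw (by linarith)
      have h4 := hhalf v x hx
      have h5 := hcon v x hx
      have h6 : w - v = (w - c) - (v - c) := by abel
      rw [h6, inner_sub_right] at h5
      linarith) w hw
    have h2 := inner_sub_sub_of_dist_eq (hR w hw) (hR v hv)
    have h3 := inner_sub_sub_of_dist_eq (hR w hw) (hR w hw)
    have h4 : 0 < dist w v ^ 2 := pow_pos (dist_pos.2 hvw.symm) 2
    rw [dist_self] at h3
    rw [inner_sub_right] at h2 h3
    linarith

end EdgeGeometry

/-! ### The icosahedron. -/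

section Icosahedron

open Real

/-- The twelve vertices of the icosahedron. -/
def icosahedronVertices : Set (EuclideanSpace ℝ (Fin 3)) :=
  {x | ∃ s t : ℝ, (s = 1 ∨ s = -1) ∧ (t = 1 ∨ t = -1) ∧
    (x = !₂[0, s * goldenRatio, t] ∨ x = !₂[s, 0, t * goldenRatio] ∨
      x = !₂[s * goldenRatio, t, 0])}

theorem icosahedron_eq : icosahedron = convexHull ℝ icosahedronVertices := rfl

theorem finite_icosahedronVertices : icosahedronVertices.Finite := by
  have h : (({1, -1} : Set ℝ) ×ˢ ({1, -1} : Set ℝ)).Finite := Set.toFinite _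
  refine (((h.image fun p => !₂[0, p.1 * goldenRatio, p.2]).union
    (h.image fun p => !₂[p.1, 0, p.2 * goldenRatio])).union
    (h.image fun p => !₂[p.1 * goldenRatio, p.2, 0])).subset ?_
  rintro x ⟨s, t, hs, ht, rfl | rfl | rfl⟩
  · exact Or.inl (Or.inl ⟨(s, t), ⟨hs, ht⟩, rfl⟩)
  · exact Or.inl (Or.inr ⟨(s, t), ⟨hs, ht⟩, rfl⟩)
  · exact Or.inr ⟨(s, t), ⟨hs, ht⟩, rfl⟩

theorem inner_vec3 (a b c a' b' c' : ℝ) :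
    inner ℝ !₂[a, b, c] !₂[a', b', c'] = a * a' + b * b' + c * c' := by
  simp [PiLp.inner_apply, Fin.sum_univ_three]
  ring

theorem vec3_ext {x : EuclideanSpace ℝ (Fin 3)} {a b c : ℝ} (h0 : x 0 = a) (h1 : x 1 = b)
    (h2 : x 2 = c) : x = !₂[a, b, c] := by
  ext i
  fin_cases i <;> simpa

theorem neg_mem_icosahedronVertices {x : EuclideanSpace ℝ (Fin 3)}
    (hx : x ∈ icosahedronVertices) : -x ∈ icosahedronVertices := by
  obtain ⟨s, t, hs, ht, h⟩ := hx
  refine ⟨-s, -t, by rcases hs with rfl | rfl <;> simp, by rcases ht with rfl | rfl <;> simp, ?_⟩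
  rcases h with rfl | rfl | rfl
  · exact Or.inl (vec3_ext (by simp) (by simp) (by simp))
  · exact Or.inr (Or.inl (vec3_ext (by simp) (by simp) (by simp)))
  · exact Or.inr (Or.inr (vec3_ext (by simp) (by simp) (by simp)))

/-- Two vertices of the same coordinate type have product ±φ² ± 1, and two of different types ±φ;
then φ² = φ + 1 leaves four values. They distinguish equal, adjacent, next-to-adjacent and antipodal
pairs. -/
theorem inner_icosahedronVertices {x y : EuclideanSpace ℝ (Fin 3)}
    (hx : x ∈ icosahedronVertices) (hy : y ∈ icosahedronVertices) :
    inner ℝ x y = goldenRatio + 2 ∨ inner ℝ x y = goldenRatio ∨ inner ℝ x y = -goldenRatio ∨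
      inner ℝ x y = -(goldenRatio + 2) := by
  have hφ := goldenRatio_sq
  have sign_mul : ∀ {a b : ℝ}, (a = 1 ∨ a = -1) → (b = 1 ∨ b = -1) → (a * b = 1 ∨ a * b = -1) := by
    rintro a b (rfl | rfl) (rfl | rfl) <;> norm_num
  have same : ∀ {z σ τ : ℝ}, (σ = 1 ∨ σ = -1) → (τ = 1 ∨ τ = -1) →
      z = σ * goldenRatio ^ 2 + τ → z = goldenRatio + 2 ∨ z = goldenRatio ∨ z = -goldenRatio ∨
        z = -(goldenRatio + 2) := by
    rintro z σ τ (rfl | rfl) (rfl | rfl) rfl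
    · exact Or.inl (by linarith)
    · exact Or.inr (Or.inl (by linarith))
    · exact Or.inr (Or.inr (Or.inl (by linarith)))
    · exact Or.inr (Or.inr (Or.inr (by linarith)))
  have cross : ∀ {z σ : ℝ}, (σ = 1 ∨ σ = -1) →
      z = σ * goldenRatio → z = goldenRatio + 2 ∨ z = goldenRatio ∨ z = -goldenRatio ∨
        z = -(goldenRatio + 2) := by
    rintro z σ (rfl | rfl) rfl
    · exact Or.inr (Or.inl (by linarith))
    · exact Or.inr (Or.inr (Or.inl (by linarith)))
  obtain ⟨s, t, hs, ht, rfl | rfl | rfl⟩ := hx <;>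
  obtain ⟨s', t', hs', ht', rfl | rfl | rfl⟩ := hy <;>
  rw [inner_vec3]
  · exact same (sign_mul hs hs') (sign_mul ht ht') (by ring)
  · exact cross (sign_mul ht ht') (by ring)
  · exact cross (sign_mul hs ht') (by ring)
  · exact cross (sign_mul ht ht') (by ring)
  · exact same (sign_mul ht ht') (sign_mul hs hs') (by ring)
  · exact cross (sign_mul hs hs') (by ring)
  · exact cross (sign_mul ht hs') (by ring)
  · exact cross (sign_mul hs hs') (by ring)
  · exact same (sign_mul hs hs') (sign_mul ht ht') (by ring)

theorem inner_self_icosahedronVertices {x : EuclideanSpace ℝ (Fin 3)}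
    (hx : x ∈ icosahedronVertices) : inner ℝ x x = goldenRatio + 2 := by
  have hφ := goldenRatio_sq
  obtain ⟨s, t, rfl | rfl, rfl | rfl, rfl | rfl | rfl⟩ := hx <;> rw [inner_vec3] <;>
  linear_combination hφ

theorem dist_sq_icosahedronVertices {x y : EuclideanSpace ℝ (Fin 3)}
    (hx : x ∈ icosahedronVertices) (hy : y ∈ icosahedronVertices) :
    dist x y ^ 2 = 2 * (goldenRatio + 2) - 2 * inner ℝ x y := by
  rw [dist_eq_norm, norm_sub_sq_real, ← real_inner_self_eq_norm_sq, ← real_inner_self_eq_norm_sq,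
    inner_self_icosahedronVertices hx, inner_self_icosahedronVertices hy]
  ring

theorem eq_of_inner_icosahedronVertices {x y : EuclideanSpace ℝ (Fin 3)}
    (hx : x ∈ icosahedronVertices) (hy : y ∈ icosahedronVertices)
    (h : inner ℝ x y = goldenRatio + 2) : x = y := by
  have := dist_sq_icosahedronVertices hx hy
  rw [h, sub_self] at this
  exact dist_eq_zero.1 (pow_eq_zero_iff two_ne_zero |>.1 this)

theorem eq_neg_of_inner_icosahedronVertices {x y : EuclideanSpace ℝ (Fin 3)}
    (hx : x ∈ icosahedronVertices) (hy : y ∈ icosahedronVertices)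
    (h : inner ℝ x y = -(goldenRatio + 2)) : y = -x :=
  (eq_of_inner_icosahedronVertices (neg_mem_icosahedronVertices hx) hy
    (by rw [inner_neg_left, h, neg_neg])).symm

theorem neg_sign {s : ℝ} (hs : s = 1 ∨ s = -1) : -s = 1 ∨ -s = -1 := by
  rcases hs with rfl | rfl <;> norm_num

theorem exists_adjacent_icosahedronVertices {x : EuclideanSpace ℝ (Fin 3)}
    (hx : x ∈ icosahedronVertices) : ∃ y ∈ icosahedronVertices, inner ℝ x y = goldenRatio := by
  have hφ := goldenRatio_sq
  obtain ⟨s, t, hs, ht, rfl | rfl | rfl⟩ := hx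
  · refine ⟨_, ⟨s, -t, hs, neg_sign ‹_›, Or.inl rfl⟩, ?_⟩
    rw [inner_vec3]
    rcases hs with rfl | rfl <;> rcases ht with rfl | rfl <;> linear_combination hφ
  · refine ⟨_, ⟨-s, t, neg_sign ‹_›, ht, Or.inr (Or.inl rfl)⟩, ?_⟩
    rw [inner_vec3]
    rcases hs with rfl | rfl <;> rcases ht with rfl | rfl <;> linear_combination hφ
  · refine ⟨_, ⟨s, -t, hs, neg_sign ‹_›, Or.inr (Or.inr rfl)⟩, ?_⟩
    rw [inner_vec3]
    rcases hs with rfl | rfl <;> rcases ht with rfl | rfl <;> linear_combination hφ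

theorem vec3_congr {a b c a' b' c' : ℝ} (ha : a = a') (hb : b = b') (hc : c = c') :
    !₂[a, b, c] = (!₂[a', b', c'] : EuclideanSpace ℝ (Fin 3)) := by
  rw [ha, hb, hc]

theorem sub_vec3 (a b c a' b' c' : ℝ) :
    !₂[a, b, c] - !₂[a', b', c'] = (!₂[a - a', b - b', c - c'] : EuclideanSpace ℝ (Fin 3)) :=
  vec3_ext (by simp) (by simp) (by simp)

theorem smul_vec3 (k a b c : ℝ) :
    k • !₂[a, b, c] = (!₂[k * a, k * b, k * c] : EuclideanSpace ℝ (Fin 3)) :=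
  vec3_ext (by simp) (by simp) (by simp)

/-- Scaling an edge vector of the icosahedron by the golden ratio gives a parallel diagonal. -/
theorem exists_diagonal_icosahedronVertices {x y : EuclideanSpace ℝ (Fin 3)}
    (hx : x ∈ icosahedronVertices) (hy : y ∈ icosahedronVertices)
    (h : inner ℝ x y = goldenRatio) :
    ∃ p ∈ icosahedronVertices, ∃ q ∈ icosahedronVertices, p - q = goldenRatio • (y - x) := by
  have hφ := goldenRatio_sq
  have hφ1 := one_lt_goldenRatio
  have swap : ∀ {x y : EuclideanSpace ℝ (Fin 3)},
      (∃ p ∈ icosahedronVertices, ∃ q ∈ icosahedronVertices, p - q = goldenRatio • (y - x)) →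
      ∃ p ∈ icosahedronVertices, ∃ q ∈ icosahedronVertices, p - q = goldenRatio • (x - y) := by
    rintro x y ⟨p, hp, q, hq, hpq⟩
    exact ⟨q, hq, p, hp, by rw [← neg_sub p q, hpq, ← smul_neg, neg_sub]⟩
  have sign_eq : ∀ {a b : ℝ}, (a = 1 ∨ a = -1) → (b = 1 ∨ b = -1) →
      b * a * goldenRatio = goldenRatio → a = b := by
    rintro a b (rfl | rfl) (rfl | rfl) h <;> linarith
  have same : ∀ {a a' b b' : ℝ}, (a = 1 ∨ a = -1) → (a' = 1 ∨ a' = -1) → (b = 1 ∨ b = -1) →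
      (b' = 1 ∨ b' = -1) → a * a' * goldenRatio ^ 2 + b * b' = goldenRatio →
      a' = a ∧ b' = -b := by
    rintro a a' b b' (rfl | rfl) (rfl | rfl) (rfl | rfl) (rfl | rfl) h <;> rw [hφ] at h <;>
    first | (exfalso; linarith) | exact ⟨by norm_num, by norm_num⟩
  -- For adjacent vertices of different types the signs in the shared coordinate match, and φ² = φ +
  -- 1 splits the scaled edge vector into a difference of two vertices.
  have h12 : ∀ s t s' t' : ℝ, (s = 1 ∨ s = -1) → (t = 1 ∨ t = -1) → (s' = 1 ∨ s' = -1) →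
      (t' = 1 ∨ t' = -1) → t * t' * goldenRatio = goldenRatio →
      ∃ p ∈ icosahedronVertices, ∃ q ∈ icosahedronVertices,
        p - q = goldenRatio • (!₂[s', 0, t' * goldenRatio] - !₂[0, s * goldenRatio, t]) := by
    intro s t s' t' hs ht hs' ht' h
    refine ⟨_, ⟨s', -s, hs', neg_sign ‹_›, Or.inr (Or.inr rfl)⟩, _,
      ⟨s, -t, hs, neg_sign ‹_›, Or.inl rfl⟩, ?_⟩
    rw [sub_vec3, sub_vec3, smul_vec3]
    obtain rfl : t' = t := sign_eq ht' ht (by linarith)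
    refine vec3_congr ?_ ?_ ?_
    · ring
    · linear_combination s * hφ
    · linear_combination (-t') * hφ
  have h13 : ∀ s t s' t' : ℝ, (s = 1 ∨ s = -1) → (t = 1 ∨ t = -1) → (s' = 1 ∨ s' = -1) →
      (t' = 1 ∨ t' = -1) → s * t' * goldenRatio = goldenRatio →
      ∃ p ∈ icosahedronVertices, ∃ q ∈ icosahedronVertices,
        p - q = goldenRatio • (!₂[s' * goldenRatio, t', 0] - !₂[0, s * goldenRatio, t]) := by
    intro s t s' t' hs ht hs' ht' h
    refine ⟨_, ⟨s', -s, hs', neg_sign ‹_›, Or.inr (Or.inr rfl)⟩, _,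
      ⟨-s', t, neg_sign ‹_›, ht, Or.inr (Or.inl rfl)⟩, ?_⟩
    rw [sub_vec3, sub_vec3, smul_vec3]
    obtain rfl : t' = s := sign_eq ht' hs (by linarith)
    refine vec3_congr ?_ ?_ ?_
    · linear_combination (-s') * hφ
    · linear_combination t' * hφ
    · ring
  have h23 : ∀ s t s' t' : ℝ, (s = 1 ∨ s = -1) → (t = 1 ∨ t = -1) → (s' = 1 ∨ s' = -1) →
      (t' = 1 ∨ t' = -1) → s * s' * goldenRatio = goldenRatio →
      ∃ p ∈ icosahedronVertices, ∃ q ∈ icosahedronVertices,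
        p - q = goldenRatio • (!₂[s' * goldenRatio, t', 0] - !₂[s, 0, t * goldenRatio]) := by
    intro s t s' t' hs ht hs' ht' h
    refine ⟨_, ⟨t', -t, ht', neg_sign ‹_›, Or.inl rfl⟩, _,
      ⟨-s, t, neg_sign ‹_›, ht, Or.inr (Or.inl rfl)⟩, ?_⟩
    rw [sub_vec3, sub_vec3, smul_vec3]
    obtain rfl : s' = s := sign_eq hs' hs (by linarith)
    refine vec3_congr ?_ ?_ ?_
    · linear_combination (-s') * hφ
    · ring
    · linear_combination t * hφ
  obtain ⟨s, t, hs, ht, rfl | rfl | rfl⟩ := hx <;>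
  obtain ⟨s', t', hs', ht', rfl | rfl | rfl⟩ := hy <;>
  rw [inner_vec3] at h
  -- Adjacent vertices of one type differ by ±2 along an axis, and the parallel diagonal joins two
  -- vertices of the type that has ±φ in that coordinate.
  · refine ⟨_, ⟨1, -t, Or.inl rfl, neg_sign ‹_›, Or.inr (Or.inl rfl)⟩, _,
      ⟨1, t, Or.inl rfl, ht, Or.inr (Or.inl rfl)⟩, ?_⟩
    rw [sub_vec3, sub_vec3, smul_vec3]
    obtain ⟨rfl, rfl⟩ := same hs hs' ht ht' (by linarith)
    refine vec3_congr ?_ ?_ ?_ <;> ring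
  · exact h12 s t s' t' hs ht hs' ht' (by linarith)
  · exact h13 s t s' t' hs ht hs' ht' (by linarith)
  · exact swap (h12 s' t' s t hs' ht' hs ht (by linarith))
  · refine ⟨_, ⟨-s, 1, neg_sign ‹_›, Or.inl rfl, Or.inr (Or.inr rfl)⟩, _,
      ⟨s, 1, hs, Or.inl rfl, Or.inr (Or.inr rfl)⟩, ?_⟩
    rw [sub_vec3, sub_vec3, smul_vec3]
    obtain ⟨rfl, rfl⟩ := same ht ht' hs hs' (by linarith)
    refine vec3_congr ?_ ?_ ?_ <;> ring
  · exact h23 s t s' t' hs ht hs' ht' (by linarith)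
  · exact swap (h13 s' t' s t hs' ht' hs ht (by linarith))
  · exact swap (h23 s' t' s t hs' ht' hs ht (by linarith))
  · refine ⟨_, ⟨-t, 1, neg_sign ‹_›, Or.inl rfl, Or.inl rfl⟩, _,
      ⟨t, 1, ht, Or.inl rfl, Or.inl rfl⟩, ?_⟩
    rw [sub_vec3, sub_vec3, smul_vec3]
    obtain ⟨rfl, rfl⟩ := same hs hs' ht ht' (by linarith)
    refine vec3_congr ?_ ?_ ?_ <;> ring

theorem isConvexPolytope_icosahedron : IsConvexPolytope icosahedron := by
  refine ⟨⟨_, finite_icosahedronVertices, rfl⟩, ?_⟩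
  have hmem : ∀ s t : ℝ, (s = 1 ∨ s = -1) → (t = 1 ∨ t = -1) →
      !₂[0, s * goldenRatio, t] ∈ icosahedronVertices ∧
      !₂[s, 0, t * goldenRatio] ∈ icosahedronVertices ∧
      !₂[s * goldenRatio, t, 0] ∈ icosahedronVertices := fun s t hs ht =>
    ⟨⟨s, t, hs, ht, Or.inl rfl⟩, ⟨s, t, hs, ht, Or.inr (Or.inl rfl)⟩,
      ⟨s, t, hs, ht, Or.inr (Or.inr rfl)⟩⟩
  obtain ⟨p2, p0, p1⟩ := hmem 1 1 (Or.inl rfl) (Or.inl rfl)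
  have q2 := (hmem 1 (-1) (Or.inl rfl) (Or.inr rfl)).1
  have q0 := (hmem (-1) 1 (Or.inr rfl) (Or.inl rfl)).2.1
  have q1 := (hmem 1 (-1) (Or.inl rfl) (Or.inr rfl)).2.2
  rw [icosahedron_eq, interior_convexHull_nonempty_iff_affineSpan_eq_top,
    AffineSubspace.affineSpan_eq_top_iff_vectorSpan_eq_top_of_nonempty ℝ _ _ ⟨_, p0⟩, eq_top_iff]
  intro x _
  -- The three differences are edges parallel to the axes, equal to twice the standard basis
  -- vectors.
  have hx : x = (x 0 / 2) • (!₂[1, 0, 1 * goldenRatio] - !₂[-1, 0, 1 * goldenRatio]) +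
      (x 1 / 2) • (!₂[1 * goldenRatio, 1, 0] - !₂[1 * goldenRatio, -1, 0]) +
      (x 2 / 2) • (!₂[0, 1 * goldenRatio, 1] - !₂[0, 1 * goldenRatio, -1]) := by
    ext i
    fin_cases i <;> simp <;> ring
  rw [hx]
  exact add_mem (add_mem (Submodule.smul_mem _ _ (vsub_mem_vectorSpan ℝ p0 q0))
    (Submodule.smul_mem _ _ (vsub_mem_vectorSpan ℝ p1 q1)))
    (Submodule.smul_mem _ _ (vsub_mem_vectorSpan ℝ p2 q2))

theorem dist_zero_icosahedronVertices {x : EuclideanSpace ℝ (Fin 3)}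
    (hx : x ∈ icosahedronVertices) : dist x 0 = √(goldenRatio + 2) := by
  rw [dist_zero_right, norm_eq_sqrt_real_inner, inner_self_icosahedronVertices hx]

/-- All twelve points lie on one sphere, and every point of a sphere is extreme in its ball. -/
theorem polytopeVertices_icosahedron : polytopeVertices icosahedron = icosahedronVertices := by
  refine Set.Subset.antisymm extremePoints_convexHull_subset fun x hx => ?_
  have hsub : icosahedron ⊆ Metric.closedBall 0 √(goldenRatio + 2) :=
    convexHull_min (fun y hy => (dist_zero_icosahedronVertices hy).le) (convex_closedBall _ _)
  exact inter_extremePoints_subset_extremePoints_of_subset hsub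
    ⟨subset_convexHull ℝ _ hx, StrictConvexSpace.sphere_subset_extremePoints_closedBall _
      (Real.sqrt_pos.2 (by linarith [one_lt_goldenRatio])).ne'
      (dist_zero_icosahedronVertices hx)⟩

/-- Pairs with product φ are nearest neighbours, hence edges. For any other pair of ends, central
symmetry makes the supporting level h nonpositive; since |l| ≤ h on all vertices, l is then constant
there and the segment would contain a third vertex. -/
theorem isEdge_icosahedron_iff {a b : EuclideanSpace ℝ (Fin 3)} :
    IsEdge icosahedron a b ↔ a ∈ icosahedronVertices ∧ b ∈ icosahedronVertices ∧
      inner ℝ a b = goldenRatio := by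
  have hP := isConvexPolytope_icosahedron
  have hV := polytopeVertices_icosahedron
  have hφ1 := one_lt_goldenRatio
  constructor
  · intro hab
    have ha := hV ▸ hP.edge_left hab
    have hb := hV ▸ hP.edge_right hab
    refine ⟨ha, hb, ?_⟩
    by_contra hne
    obtain ⟨l, h, hl, hseg⟩ := hab.2.exists_support
    have hlV : ∀ v ∈ icosahedronVertices, inner ℝ l v ≤ h := fun v hv =>
      hl v (subset_convexHull ℝ _ hv)
    have hla : inner ℝ l a = h := (hseg.subset (left_mem_segment ℝ a b)).2
    have hlb : inner ℝ l b = h := (hseg.subset (right_mem_segment ℝ a b)).2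
    have hneg : ∀ v ∈ icosahedronVertices, -inner ℝ l v ≤ h := fun v hv => by
      rw [← inner_neg_right]
      exact hlV _ (neg_mem_icosahedronVertices hv)
    have h0 : h ≤ 0 := by
      rcases inner_icosahedronVertices ha hb with h1 | h1 | h1 | h1
      · exact absurd (eq_of_inner_icosahedronVertices ha hb h1) hab.1
      · exact absurd h1 hne
      -- Here φ(a + b) = p - q, so 2φh ≤ 2h, and φ > 1 gives h ≤ 0.
      · obtain ⟨p, hp, q, hq, hpq⟩ := exists_diagonal_icosahedronVertices
          (neg_mem_icosahedronVertices ha) hb (by rw [inner_neg_left, h1, neg_neg])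
        have h2 : inner ℝ l (p - q) = goldenRatio * (h + h) := by
          rw [hpq, real_inner_smul_right, sub_neg_eq_add, inner_add_right, hla, hlb]
        rw [inner_sub_right] at h2
        have h3 := hlV p hp
        have h4 := hneg q hq
        nlinarith
      · have h2 := eq_neg_of_inner_icosahedronVertices ha hb h1
        rw [h2, inner_neg_right, hla] at hlb
        linarith
    obtain ⟨x, hx, hax⟩ := exists_adjacent_icosahedronVertices ha
    have hlx : inner ℝ l x = h := by
      have h1 := hlV x hx
      have h2 := hneg x hx
      have h3 := hneg a ha
      linarith
    have hxs : x ∈ segment ℝ a b ∩ polytopeVertices icosahedron := by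
      rw [hseg, hV]
      exact ⟨⟨subset_convexHull ℝ _ hx, hlx⟩, hx⟩
    rw [hP.edge_vertices hab] at hxs
    rcases hxs with rfl | rfl
    · rw [inner_self_icosahedronVertices hx] at hax
      linarith
    · exact hne hax
  · rintro ⟨ha, hb, h⟩
    refine hP.isEdge_of_forall_dist_le (c := 0) (R := √(goldenRatio + 2))
      (fun v hv => dist_zero_icosahedronVertices (hV ▸ hv)) hP.isFace_self (hV ▸ ha)
      (subset_convexHull ℝ _ ha) (hV ▸ hb) (subset_convexHull ℝ _ hb) ?_ ?_
    · rintro rfl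
      rw [inner_self_icosahedronVertices ha] at h
      linarith
    · rintro x ⟨-, hx⟩ hxa
      rw [hV] at hx
      refine (sq_le_sq₀ dist_nonneg dist_nonneg).1 ?_
      rw [dist_sq_icosahedronVertices ha hb, dist_sq_icosahedronVertices ha hx, h]
      rcases inner_icosahedronVertices ha hx with h1 | h1 | h1 | h1
      · exact absurd (eq_of_inner_icosahedronVertices ha hx h1).symm hxa
      all_goals linarith

/-- The bound could fail only for the extreme values φ + 2 and -(φ + 2), where p is b or -a and the
difference is 2. -/
theorem inner_sub_le_icosahedronVertices {a b p : EuclideanSpace ℝ (Fin 3)}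
    (ha : a ∈ icosahedronVertices) (hb : b ∈ icosahedronVertices) (hp : p ∈ icosahedronVertices)
    (h : inner ℝ a b = goldenRatio) : inner ℝ b p - inner ℝ a p ≤ 2 * goldenRatio := by
  have hφ1 := one_lt_goldenRatio
  have hb' : inner ℝ b p = goldenRatio + 2 → inner ℝ a p = goldenRatio := fun h1 => by
    rw [← eq_of_inner_icosahedronVertices hb hp h1, h]
  have ha' : inner ℝ a p = -(goldenRatio + 2) → inner ℝ b p = -goldenRatio := fun h1 => by
    rw [eq_neg_of_inner_icosahedronVertices ha hp h1, inner_neg_right, real_inner_comm, h]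
  rcases inner_icosahedronVertices hb hp with h1 | h1 | h1 | h1
  · linarith [hb' h1]
  all_goals
    rcases inner_icosahedronVertices ha hp with h2 | h2 | h2 | h2
    · linarith
    · linarith
    · linarith
    · linarith [ha' h2]

theorem hasEdgeGeometry_icosahedron : HasEdgeGeometry icosahedron 2 (2 * goldenRatio) := by
  have hφ1 := one_lt_goldenRatio
  have hV := polytopeVertices_icosahedron
  refine ⟨isConvexPolytope_icosahedron, two_pos, by linarith, fun a b hab => ?_, fun v hv => ?_,
    fun a b hab p hp q hq => ?_, fun a b hab => ?_, fun v hv w hw hvw => ?_⟩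
  · obtain ⟨ha, hb, h⟩ := isEdge_icosahedron_iff.1 hab
    have h1 := dist_sq_icosahedronVertices ha hb
    rw [h] at h1
    refine (sq_eq_sq₀ dist_nonneg zero_le_two).1 ?_
    linarith
  · rw [hV] at hv
    obtain ⟨x, hx, hvx⟩ := exists_adjacent_icosahedronVertices hv
    exact ⟨x, isEdge_icosahedron_iff.2 ⟨hv, hx, hvx⟩⟩
  · rw [hV] at hp hq
    obtain ⟨ha, hb, h⟩ := isEdge_icosahedron_iff.1 hab
    have h1 := inner_sub_le_icosahedronVertices ha hb hp h
    have h2 := inner_sub_le_icosahedronVertices hb ha hq (by rw [real_inner_comm, h])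
    rw [inner_sub_left, inner_sub_right, inner_sub_right]
    linarith
  · obtain ⟨ha, hb, h⟩ := isEdge_icosahedron_iff.1 hab
    rw [hV, mul_div_cancel_left₀ _ (two_ne_zero (α := ℝ))]
    exact exists_diagonal_icosahedronVertices ha hb h
  · rw [hV] at hv hw
    have hself := inner_self_icosahedronVertices hv
    have key : ∀ x ∈ icosahedronVertices, inner ℝ v x = goldenRatio →
        4 ≤ inner ℝ w x - inner ℝ w v + 2 →
        ∃ a b, IsEdge icosahedron a b ∧ 2 ^ 2 ≤ inner ℝ (b - a) (w - v) := by
      intro x hx hvx h4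
      refine ⟨v, x, isEdge_icosahedron_iff.2 ⟨hv, hx, hvx⟩, ?_⟩
      rw [inner_sub_left, inner_sub_right, inner_sub_right, real_inner_comm w x,
        real_inner_comm v x, real_inner_comm w v, hvx, hself]
      linarith
    rcases inner_icosahedronVertices hv hw with h | h | h | h
    · exact absurd (eq_of_inner_icosahedronVertices hv hw h) hvw
    · refine key w hw h ?_
      rw [inner_self_icosahedronVertices hw, real_inner_comm, h]
      linarith
    -- The separating edge runs from v to a common neighbour p of v and w. Since p + (-q) = φ(v +
    -- w), the products of v with p and -q sum to 2φ, which among the four values is only φ + φ; the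
    -- same holds for w.
    · obtain ⟨p, hp, q, hq, hpq⟩ := exists_diagonal_icosahedronVertices
        (neg_mem_icosahedronVertices hv) hw (by rw [inner_neg_left, h, neg_neg])
      have hq' := neg_mem_icosahedronVertices hq
      have h1 : ∀ z, inner ℝ z p + inner ℝ z (-q) =
          goldenRatio * (inner ℝ z w + inner ℝ z v) := by
        intro z
        rw [← inner_add_right, ← sub_eq_add_neg, hpq, real_inner_smul_right, sub_neg_eq_add,
          inner_add_right]
      have hval : ∀ z ∈ icosahedronVertices,
          inner ℝ z p + inner ℝ z (-q) = 2 * goldenRatio → inner ℝ z p = goldenRatio := by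
        intro z hz hsum
        rcases inner_icosahedronVertices hz hp with h2 | h2 | h2 | h2 <;>
        rcases inner_icosahedronVertices hz hq' with h3 | h3 | h3 | h3 <;>
        linarith
      have hw' := inner_self_icosahedronVertices hw
      have hvp := hval v hv (by rw [h1, h, hself]; ring)
      have hwp := hval w hw (by rw [h1, real_inner_comm v w, h, hw']; ring)
      refine key p hp hvp ?_
      rw [hwp, real_inner_comm, h]
      linarith
    -- For antipodal vertices any edge at v separates, with equality in the bound.
    · obtain ⟨x, hx, hvx⟩ := exists_adjacent_icosahedronVertices hv
      refine key x hx hvx ?_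
      rw [eq_neg_of_inner_icosahedronVertices hv hw h, inner_neg_left, inner_neg_left, hvx, hself]
      linarith

end Icosahedron

theorem mainTheorem1 :
    (∀ (n : ℕ), 1 ≤ n → ∀ (P : Set (EuclideanSpace ℝ (Fin n))), IsRegularPolytope P →
      ∃ ℓ δ : ℝ, HasEdgeLength P ℓ ∧ IsGreatest (edgeParallelDistances P) δ ∧
        ∀ r : ℝ, IsOptimalRatio P r ↔ r = δ / (δ + ℓ)) ∧
    (HasEdgeLength icosahedron 2 ∧
      IsGreatest (edgeParallelDistances icosahedron) (2 * Real.goldenRatio) ∧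
      ∀ r : ℝ, IsOptimalRatio icosahedron r ↔ r = 1 / Real.goldenRatio) := by
  refine ⟨fun n hn P hP => ?_, hasEdgeGeometry_icosahedron.hasEdgeLength,
    hasEdgeGeometry_icosahedron.isGreatest, fun r => ?_⟩
  · obtain ⟨ℓ, δ, h⟩ := hP.hasEdgeGeometry hn
    exact ⟨ℓ, δ, h.hasEdgeLength, h.isGreatest, h.isOptimalRatio_iff⟩
  · have hφ := Real.goldenRatio_pos
    have heq : 2 * Real.goldenRatio / (2 * Real.goldenRatio + 2) = 1 / Real.goldenRatio := by
      rw [div_eq_div_iff (by positivity) hφ.ne']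
      linear_combination 2 * Real.goldenRatio_sq
    rw [hasEdgeGeometry_icosahedron.isOptimalRatio_iff, heq]
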